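/- **Setting.** Let $n\ge 0$ and write $\partial_k=\partial/\partial z_k$, $\partial_{\bar k}=\partial/\partial\bar z_k$ for $1\le k\le n+1$. Let $g$ be the complex bilinear extension of the Euclidean metric of $\mathbb C^{n+1}$, so that $g(\partial_h,\partial_{\bar k})=g(\partial_{\bar h},\partial_k)=\tfrac12\delta_{hk}$ and $g(\partial_h,\partial_k)=g(\partial_{\bar h},\partial_{\bar k})=0$. Let $D$ be the standard flat connection and $J$ the standard complex structure. Let $M\subset\mathbb C^{n+1}$ be a smooth embedded real hypersurface, $\nu$ a smooth real unit normal field, defined on an open piece of $M$ (every $M$ has one locally), and $T=J\nu$, $N=\frac1{\sqrt2}(\nu-iT)$. Let $\mathcal H=T^{1,0}M=\{V\in\mathbb C TM: JV=iV\}$, so that $\mathbb C TM=\mathcal H\oplus\overline{\mathcal H}\oplus\mathbb C T$. For $U,V\in\mathbb C TM$ let $h(U,V)=g(U,D_V\nu)$ be the complexified second fundamental form. For sections $U$ and $V=Z+\bar W+fT$ of $\mathbb C TM$, with $Z,W$ sections of $\mathcal H$ and $f$ a complex function, put $$\nabla_UV=D_UZ-g(D_UZ,\bar N)N+D_U\bar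 W-g(D_U\bar W,N)\bar N+(Uf)\,T,$$ and let $$(\nabla_Xh)(U,V)=X\big(h(U,V)\big)-h(\nabla_XU,V)-h(U,\nabla_XV).$$ Let $Z_1,\dots,Z_n$ be any smooth local frame of $\mathcal H$, defined where $\nu$ is. Put $Z_{\bar\alpha}=\overline{Z_\alpha}$ and $Z_0=T$. For indices $A,B,C$ in $\{\alpha,\bar\alpha,0\}$ let $h_{AB}=h(Z_A,Z_B)$ and $\nabla_Ch_{AB}=(\nabla_{Z_C}h)(Z_A,Z_B)$. Let $g_{\alpha\bar\beta}=g(Z_\alpha,Z_{\bar\beta})$, and let $g^{\alpha\bar\beta}$ be defined by $\sum_\beta g^{\alpha\bar\beta}g_{\gamma\bar\beta}=\delta_{\alpha\gamma}$. Put $h^\lambda_A=h_A^\lambda=\sum_\mu g^{\lambda\bar\mu}h_{\bar\mu A}$ and $h^{\bar\lambda}_A=h_A^{\bar\lambda}=\sum_\mu g^{\mu\bar\lambda}h_{\mu A}$. Repeated indices $\lambda,\bar\lambda$ are summed from $1$ to $n$. **Theorem 4.1 (Codazzi equations).** At every point where $\nu$ and the frame are defined, and for all $\alpha,\beta,\gamma\in\{1,\dots,n\}$,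 $$\nabla_\beta h_{\alpha\bar\gamma}-\nabla_{\bar\gamma}h_{\alpha\beta}=i\,h_{\alpha\beta}h_{\bar\gamma0}-i\,h_{\alpha\bar\gamma}h_{\beta0}-2i\,h_{\beta\bar\gamma}h_{\alpha0},$$ $$\nabla_{\bar\beta}h_{\alpha0}-\nabla_0h_{\alpha\bar\beta}=i\,h_{\alpha\lambda}h^\lambda_{\bar\beta}-i\,h_{\alpha\bar\lambda}h^{\bar\lambda}_{\bar\beta}+i\,h_{\alpha\bar\beta}h_{00},$$ $$\nabla_\beta h_{\alpha0}-\nabla_0h_{\alpha\beta}=i\,h_{\beta\bar\lambda}h^{\bar\lambda}_\alpha-i\,h_{\beta\lambda}h^\lambda_\alpha+i\,h_{\alpha\beta}h_{00}-2i\,h_{\alpha0}h_{\beta0},$$ $$\nabla_\alpha h_{00}-\nabla_0h_{\alpha0}=2i\,h_\alpha^\lambda h_{\lambda0}-2i\,h_\alpha^{\bar\lambda}h_{\bar\lambda0}-i\,h_{\alpha\lambda}h^\lambda_0+i\,h_{\alpha\bar\lambda}h^{\bar\lambda}_0-i\,h_{\alpha0}h_{00}.$$ -/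

import Mathlib

open scoped ContDiff

namespace CRHypersurface

noncomputable section

/-- The ambient space `ℂ^{n+1}`. It is used as a real vector space; its norm only serves to define
smoothness and derivatives, while all metric quantities use the form `g` below. -/
abbrev Amb (n : ℕ) : Type := Fin (n + 1) → ℂ

/-- A complexified tangent vector `∑ aₖ ∂/∂zₖ + ∑ bₖ ∂/∂z̄ₖ` of `ℂ^{n+1}`, recorded as the pair
`(a, b)` of its coordinates. -/
abbrev CVec (n : ℕ) : Type := Amb n × Amb n

/-- A real tangent vector `v` of `ℂ^{n+1}`, as the complexified vector
`∑ vₖ ∂/∂zₖ + ∑ v̄ₖ ∂/∂z̄ₖ`. -/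
def ofReal {n : ℕ} (v : Amb n) : CVec n := (v, star v)

/-- Complex conjugation of complexified vectors; its fixed points are the `ofReal v`. -/
def conj {n : ℕ} (V : CVec n) : CVec n := (star V.2, star V.1)

/-- The real part of a complexified vector: `V = ofReal (re V) + i • ofReal (im V)`. -/
def re {n : ℕ} (V : CVec n) : Amb n := (1 / 2 : ℂ) • (V.1 + star V.2)

/-- The imaginary part of a complexified vector: `V = ofReal (re V) + i • ofReal (im V)`. -/
def im {n : ℕ} (V : CVec n) : Amb n := (-Complex.I / 2) • (V.1 - star V.2)

theorem ofReal_re_add_im {n : ℕ} (V : CVec n) :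
    ofReal (re V) + Complex.I • ofReal (im V) = V := by
  ext k
  · simp [ofReal, re, im]
    ring_nf
    simp
    ring
  · simp [ofReal, re, im]
    ring_nf
    simp
    ring

/-- The standard complex structure: `∂/∂zₖ ↦ i ∂/∂zₖ` and `∂/∂z̄ₖ ↦ -i ∂/∂z̄ₖ`. -/
def J {n : ℕ} (V : CVec n) : CVec n := (Complex.I • V.1, -Complex.I • V.2)

theorem J_ofReal {n : ℕ} (v : Amb n) : J (ofReal v) = ofReal (Complex.I • v) := by
  ext k <;> simp [J, ofReal]

/-- The complex bilinear extension of the Euclidean metric: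
`g(∂/∂zₕ, ∂/∂z̄ₖ) = δₕₖ / 2` and `g(∂/∂zₕ, ∂/∂zₖ) = g(∂/∂z̄ₕ, ∂/∂z̄ₖ) = 0`. -/
def g {n : ℕ} (V W : CVec n) : ℂ := (1 / 2 : ℂ) * ∑ k, (V.1 k * W.2 k + V.2 k * W.1 k)

/-- On real vectors `g` is the Euclidean inner product `Re ∑ vₖ w̄ₖ`. -/
theorem g_ofReal {n : ℕ} (v w : Amb n) :
    g (ofReal v) (ofReal w) = ((∑ k, (v k * star (w k)).re : ℝ) : ℂ) := by
  simp only [g, ofReal, Complex.ofReal_sum, Finset.mul_sum]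
  refine Finset.sum_congr rfl fun k _ => ?_
  apply Complex.ext
  · simp
    ring
  · simp
    ring

/-- A smooth embedded real hypersurface of `ℂ^{n+1}`: locally the zero set of a smooth real
function with non-vanishing differential. -/
def IsRealHypersurface {n : ℕ} (M : Set (Amb n)) : Prop :=
  ∀ p ∈ M, ∃ U : Set (Amb n), IsOpen U ∧ p ∈ U ∧ ∃ F : Amb n → ℝ, ContDiffOn ℝ ∞ F U ∧
    (∀ q ∈ U, q ∈ M ↔ F q = 0) ∧ ∀ q ∈ M ∩ U, fderiv ℝ F q ≠ 0

/-- A function on the set `S` is smooth if near each point of `S` it extends to a smooth function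
on an open set of the ambient space. -/
def SmoothOn {n : ℕ} {F : Type*} [NormedAddCommGroup F] [NormedSpace ℝ F]
    (S : Set (Amb n)) (f : Amb n → F) : Prop :=
  ∀ p ∈ S, ∃ U : Set (Amb n), IsOpen U ∧ p ∈ U ∧ ∃ f' : Amb n → F, ContDiffOn ℝ ∞ f' U ∧
    ∀ q ∈ S ∩ U, f q = f' q

/-- The real tangent space of `M` at `p`. -/
def tangentSpace {n : ℕ} (M : Set (Amb n)) (p : Amb n) : Submodule ℝ (Amb n) :=
  Submodule.span ℝ (tangentConeAt ℝ M p)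

/-- Derivatives relative to `M` are well defined in tangential directions: they can be computed
with any differentiable local extension. -/
theorem fderivWithin_eq_of_extension {n : ℕ} {F : Type*} [NormedAddCommGroup F] [NormedSpace ℝ F]
    {M : Set (Amb n)} {p : Amb n} (hp : p ∈ M) {f f' : Amb n → F}
    (hf' : DifferentiableAt ℝ f' p) (h : f =ᶠ[nhdsWithin p M] f') {v : Amb n}
    (hv : v ∈ tangentSpace M p) : fderivWithin ℝ f M p v = fderiv ℝ f' p v := by
  have h1 : HasFDerivWithinAt f (fderiv ℝ f' p) M p :=
    hf'.hasFDerivAt.hasFDerivWithinAt.congr_of_eventuallyEq h (h.eq_of_nhdsWithin hp)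
  have h2 := h1.differentiableWithinAt.hasFDerivWithinAt
  have h3 := h2.unique_on h1
  exact LinearMap.eqOn_span (f := (fderivWithin ℝ f M p).toLinearMap)
    (g := (fderiv ℝ f' p).toLinearMap) h3 hv

/-- The complexified tangent space `ℂ T_p M`. -/
def complexTangent {n : ℕ} (M : Set (Amb n)) (p : Amb n) : Set (CVec n) :=
  {V | re V ∈ tangentSpace M p ∧ im V ∈ tangentSpace M p}

/-- The holomorphic tangent space `ℋ_p = T^{1,0}_p M`: the complexified tangent vectors of `M` on
which `J` acts as multiplication by `i`. -/
def holTangent {n : ℕ} (M : Set (Amb n)) (p : Amb n) : Set (CVec n) :=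
  {V | V ∈ complexTangent M p ∧ J V = Complex.I • V}

/-- `D_V f` at `p`: the derivative at `p` of a function `f` given on `M`, extended complex linearly
to directions `V` in `ℂ T_p M`. For complex-valued `f` this is `V f`; for a field `f` of
complexified vectors, in coordinates with respect to `∂/∂zₖ, ∂/∂z̄ₖ`, this is the standard flat
connection of `ℂ^{n+1}`. -/
def D {n : ℕ} {F : Type*} [NormedAddCommGroup F] [NormedSpace ℝ F] [Module ℂ F]
    (M : Set (Amb n)) (f : Amb n → F) (p : Amb n) (V : CVec n) : F :=
  fderivWithin ℝ f M p (re V) + Complex.I • fderivWithin ℝ f M p (im V)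

/-- `ν` is a smooth real unit normal field of `M`, given on `M ∩ O`. -/
structure IsUnitNormalOn {n : ℕ} (M O : Set (Amb n)) (ν : Amb n → Amb n) : Prop where
  smooth : SmoothOn (M ∩ O) ν
  unit : ∀ p ∈ M ∩ O, g (ofReal (ν p)) (ofReal (ν p)) = 1
  normal : ∀ p ∈ M ∩ O, ∀ v ∈ tangentSpace M p, g (ofReal (ν p)) (ofReal v) = 0

/-- `Z₁, …, Zₙ` is a smooth frame of the bundle `ℋ = T^{1,0} M` over `M ∩ O`. -/
structure IsHolFrameOn {n : ℕ} (M O : Set (Amb n)) (Z : Fin n → Amb n → CVec n) : Prop where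
  smooth : ∀ α, SmoothOn (M ∩ O) (Z α)
  indep : ∀ p ∈ M ∩ O, LinearIndependent ℂ fun α => Z α p
  span : ∀ p ∈ M ∩ O, (Submodule.span ℂ (Set.range fun α => Z α p) : Set (CVec n)) = holTangent M p

/-- The tangent field `T = J ν`. -/
def T {n : ℕ} (ν : Amb n → Amb n) (p : Amb n) : CVec n := J (ofReal (ν p))

/-- The holomorphic unit normal `N = (ν - i T) / √2`. -/
def N {n : ℕ} (ν : Amb n → Amb n) (p : Amb n) : CVec n :=
  ((Real.sqrt 2 : ℝ) : ℂ)⁻¹ • (ofReal (ν p) - Complex.I • T ν p)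

/-- The conjugate of a field of complexified vectors. -/
def conjField {n : ℕ} (V : Amb n → CVec n) (p : Amb n) : CVec n := conj (V p)

/-- The complexified second fundamental form `h(U, V) = g(U, D_V ν)` at `p`. -/
def sff {n : ℕ} (M : Set (Amb n)) (ν : Amb n → Amb n) (p : Amb n) (U V : CVec n) : ℂ :=
  g U (D M (fun q => ofReal (ν q)) p V)

/-- The coefficient `f = g(V, T)` in the decomposition `V = Z + W̄ + f T` of a section of `ℂ T M`
along `ℋ ⊕ ℋ̄ ⊕ ℂ T`. -/
def tPart {n : ℕ} (ν : Amb n → Amb n) (V : Amb n → CVec n) (p : Amb n) : ℂ := g (V p) (T ν p)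

/-- The component `Z` in `ℋ` in the decomposition `V = Z + W̄ + f T`. -/
def holPart {n : ℕ} (ν : Amb n → Amb n) (V : Amb n → CVec n) (p : Amb n) : CVec n :=
  ((V p - tPart ν V p • T ν p).1, 0)

/-- The component `W̄` in `ℋ̄` in the decomposition `V = Z + W̄ + f T`. -/
def antiholPart {n : ℕ} (ν : Amb n → Amb n) (V : Amb n → CVec n) (p : Amb n) : CVec n :=
  (0, (V p - tPart ν V p • T ν p).2)

theorem decomposition {n : ℕ} (ν : Amb n → Amb n) (V : Amb n → CVec n) (p : Amb n) :
    V p = holPart ν V p + antiholPart ν V p + tPart ν V p • T ν p := by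
  ext k <;> simp [holPart, antiholPart]

/-- The connection
`∇_U V = D_U Z - g(D_U Z, N̄) N + D_U W̄ - g(D_U W̄, N) N̄ + (U f) T` for `V = Z + W̄ + f T`. -/
def nabla {n : ℕ} (M : Set (Amb n)) (ν : Amb n → Amb n) (U V : Amb n → CVec n) (p : Amb n) :
    CVec n :=
  (D M (holPart ν V) p (U p) - g (D M (holPart ν V) p (U p)) (conj (N ν p)) • N ν p) +
  (D M (antiholPart ν V) p (U p) - g (D M (antiholPart ν V) p (U p)) (N ν p) • conj (N ν p)) +
  D M (tPart ν V) p (U p) • T ν p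

/-- The covariant derivative
`(∇_X h)(U, V) = X (h(U, V)) - h(∇_X U, V) - h(U, ∇_X V)` at `p`. -/
def nablaSff {n : ℕ} (M : Set (Amb n)) (ν : Amb n → Amb n) (X U V : Amb n → CVec n) (p : Amb n) :
    ℂ :=
  D M (fun q => sff M ν q (U q) (V q)) p (X p) - sff M ν p (nabla M ν X U p) (V p) -
    sff M ν p (U p) (nabla M ν X V p)

/-- The matrix `g_{αβ̄} = g(Z_α, Z̄_β)`. -/
def gram {n : ℕ} (Z : Fin n → Amb n → CVec n) (p : Amb n) : Matrix (Fin n) (Fin n) ℂ :=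
  Matrix.of fun α β => g (Z α p) (conj (Z β p))

/-- The inverse metric `g^{αβ̄}`, normalised by `∑_β g^{αβ̄} g_{γβ̄} = δ_{αγ}`. -/
def gInv {n : ℕ} (Z : Fin n → Amb n → CVec n) (p : Amb n) (α β : Fin n) : ℂ :=
  (gram Z p)⁻¹ β α

/-- The raised component `h^λ(V) = ∑_μ g^{λμ̄} h(Z̄_μ, V)`. -/
def sffUp {n : ℕ} (M : Set (Amb n)) (ν : Amb n → Amb n) (Z : Fin n → Amb n → CVec n) (p : Amb n)
    (l : Fin n) (V : CVec n) : ℂ :=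
  ∑ m, gInv Z p l m * sff M ν p (conj (Z m p)) V

/-- The raised component `h^λ̄(V) = ∑_μ g^{μλ̄} h(Z_μ, V)`. -/
def sffUpBar {n : ℕ} (M : Set (Amb n)) (ν : Amb n → Amb n) (Z : Fin n → Amb n → CVec n) (p : Amb n)
    (l : Fin n) (V : CVec n) : ℂ :=
  ∑ m, gInv Z p m l * sff M ν p (Z m p) V

end

end CRHypersurface

namespace CRHypersurface

open Filter Topology

/-! ### Algebra of complexified vectors -/

section Algebra

variable {n : ℕ}

/-! The ambient connection `D` is flat, so the Codazzi equation for `D` only expresses the symmetry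
of second derivatives. Extending `ν` off `M` and differentiating `g(U, D_V ν)` along `X`, the
Hessian of `ν` cancels on exchanging `X` and `V` (`D_sff_sub_D_sff`).

The right-hand sides of the theorem come from the difference tensor `D - ∇`, computed in
`D_sub_nabla`. Differentiating the orthogonality of a field `Z` of type (1,0) to `ν` and `T = Jν`
shows that `∇` removes from `D_X Z` exactly `-h(Z,X)(ν - iT)`. The conjugate statement holds for
type (0,1), and `D_X (fT)` contributes the extra term `f J D_X ν`. Since `h(ν, ·) = 0` on tangent
vectors, inserting this difference into `h` leaves products of `h` with `h(T, ·)` and the skew form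
`g(J D_X ν, D_Y ν)`. This gives one identity for arbitrary tangent fields, `nablaSff_sub_nablaSff`.

All four equations are specialisations of that identity to fields among `Z_α`, `Z_ᾱ`, `T`. The skew
form is made explicit in `g_J_D_normal`: `D_X ν` is tangent, and on its frame expansion `J` acts by
`±i` on the two holomorphic types and sends `T` to `-ν`. Symmetry of `h` (`sff_comm`), used
throughout, comes from the Hessian of a defining function. -/

theorem g_comm (V W : CVec n) : g V W = g W V := by
  simp only [g]
  congr 1
  exact Finset.sum_congr rfl fun k _ => by ring

theorem g_add_left (U V W : CVec n) : g (U + V) W = g U W + g V W := by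
  simp only [g, Prod.fst_add, Prod.snd_add, Pi.add_apply, ← mul_add, ← Finset.sum_add_distrib]
  congr 1
  exact Finset.sum_congr rfl fun k _ => by ring

theorem g_smul_left (c : ℂ) (V W : CVec n) : g (c • V) W = c * g V W := by
  simp only [g, Prod.smul_fst, Prod.smul_snd, Pi.smul_apply, smul_eq_mul, Finset.mul_sum]
  exact Finset.sum_congr rfl fun k _ => by ring

theorem g_add_right (U V W : CVec n) : g U (V + W) = g U V + g U W := by
  rw [g_comm, g_add_left, g_comm V, g_comm W]

theorem g_smul_right (c : ℂ) (V W : CVec n) : g V (c • W) = c * g V W := by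
  rw [g_comm, g_smul_left, g_comm]

/-- The form `g` as a bilinear map. -/
noncomputable def gBilin (n : ℕ) : CVec n →ₗ[ℂ] CVec n →ₗ[ℂ] ℂ :=
  LinearMap.mk₂ ℂ g g_add_left g_smul_left g_add_right g_smul_right

theorem gBilin_apply (V W : CVec n) : gBilin n V W = g V W := rfl

theorem g_zero_right (V : CVec n) : g V 0 = 0 := by simp [← gBilin_apply]

theorem g_sub_left (U V W : CVec n) : g (U - V) W = g U W - g V W := by simp [← gBilin_apply]

theorem g_sub_right (U V W : CVec n) : g U (V - W) = g U V - g U W := by simp [← gBilin_apply]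

theorem g_neg_left (V W : CVec n) : g (-V) W = -g V W := by simp [← gBilin_apply]

theorem g_sum_left {ι : Type*} (s : Finset ι) (V : ι → CVec n) (W : CVec n) :
    g (∑ i ∈ s, V i) W = ∑ i ∈ s, g (V i) W := by
  simp [← gBilin_apply, LinearMap.sum_apply]

/-- `g` pairs only opposite types, on which `J` has eigenvalues `i` and `-i`; hence `J` is skew for
`g`. -/
theorem g_J_left (V W : CVec n) : g (J V) W = -g V (J W) := by
  simp only [g, J, Pi.smul_apply, smul_eq_mul, Finset.mul_sum, ← Finset.sum_neg_distrib]
  exact Finset.sum_congr rfl fun k _ => by simp; ring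

theorem J_add (V W : CVec n) : J (V + W) = J V + J W := by
  ext k <;> simp [J]

theorem J_smul (c : ℂ) (V : CVec n) : J (c • V) = c • J V := by
  ext k <;> simp [J] <;> ring

theorem J_J (V : CVec n) : J (J V) = -V := by
  ext k <;> simp [J, ← mul_assoc]

/-- The complex structure as a linear map. -/
noncomputable def JLin (n : ℕ) : CVec n →ₗ[ℂ] CVec n where
  toFun := J
  map_add' := J_add
  map_smul' := J_smul

theorem JLin_apply (V : CVec n) : JLin n V = J V := rfl

theorem J_sum {ι : Type*} (s : Finset ι) (V : ι → CVec n) :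
    J (∑ i ∈ s, V i) = ∑ i ∈ s, J (V i) := by
  simp [← JLin_apply]

theorem g_self_J (V : CVec n) : g V (J V) = 0 := by
  have h := g_J_left V V
  rw [g_comm] at h
  linear_combination h / 2

theorem conj_conj (V : CVec n) : conj (conj V) = V := by
  simp [conj]

theorem conj_add (V W : CVec n) : conj (V + W) = conj V + conj W := by
  simp [conj]

theorem conj_smul (c : ℂ) (V : CVec n) : conj (c • V) = star c • conj V := by
  simp [conj]

theorem conj_sub (V W : CVec n) : conj (V - W) = conj V - conj W := by
  simp [conj]

theorem conj_ofReal (v : Amb n) : conj (ofReal v) = ofReal v := by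
  simp [conj, ofReal]

theorem g_conj (V W : CVec n) : g (conj V) (conj W) = star (g V W) := by
  simp only [g, conj, star_mul', star_sum, star_add, Pi.star_apply, star_div₀, star_one]
  congr 1
  · simp
  · exact Finset.sum_congr rfl fun k _ => by ring

theorem re_add (V W : CVec n) : re (V + W) = re V + re W := by
  ext k; simp [re]; ring

theorem re_I_smul (V : CVec n) : re (Complex.I • V) = -im V := by
  ext k; simp [re, im]; ring

theorem im_add (V W : CVec n) : im (V + W) = im V + im W := by
  ext k; simp [im]; ring

theorem im_I_smul (V : CVec n) : im (Complex.I • V) = re V := by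
  ext k; simp [re, im]; ring_nf; simp; ring

theorem re_real_smul (c : ℝ) (V : CVec n) : re (c • V) = c • re V := by
  ext k; simp [re]; ring

theorem im_real_smul (c : ℝ) (V : CVec n) : im (c • V) = c • im V := by
  ext k; simp [im]; ring

theorem re_conj (V : CVec n) : re (conj V) = re V := by
  ext k; simp [re, conj]; ring

theorem im_conj (V : CVec n) : im (conj V) = -im V := by
  ext k; simp [im, conj]; ring

theorem re_ofReal (v : Amb n) : re (ofReal v) = v := by
  ext k; simp [re, ofReal]; ring

theorem im_ofReal (v : Amb n) : im (ofReal v) = 0 := by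
  ext k; simp [im, ofReal]

theorem smul_eq_re_im (c : ℂ) (V : CVec n) : c • V = c.re • V + Complex.I • (c.im • V) := by
  ext k
  · simp only [Prod.smul_fst, Prod.fst_add, Pi.smul_apply, Pi.add_apply, Complex.real_smul,
      smul_eq_mul]
    conv_lhs => rw [← Complex.re_add_im c]
    ring
  · simp only [Prod.smul_snd, Prod.snd_add, Pi.smul_apply, Pi.add_apply, Complex.real_smul,
      smul_eq_mul]
    conv_lhs => rw [← Complex.re_add_im c]
    ring

/-- The real part as a continuous real linear map. -/
noncomputable def reCLM (n : ℕ) : CVec n →L[ℝ] Amb n :=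
  LinearMap.toContinuousLinearMap
    { toFun := re, map_add' := re_add, map_smul' := re_real_smul }

/-- The imaginary part as a continuous real linear map. -/
noncomputable def imCLM (n : ℕ) : CVec n →L[ℝ] Amb n :=
  LinearMap.toContinuousLinearMap
    { toFun := im, map_add' := im_add, map_smul' := im_real_smul }

theorem reCLM_apply (V : CVec n) : reCLM n V = re V := rfl

theorem imCLM_apply (V : CVec n) : imCLM n V = im V := rfl

/-- Conjugation as a continuous real linear map. -/
noncomputable def conjCLM (n : ℕ) : CVec n →L[ℝ] CVec n :=
  LinearMap.toContinuousLinearMap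
    { toFun := conj, map_add' := conj_add, map_smul' := fun c V => by ext k <;> simp [conj] }

/-- The inclusion of the real vectors as a continuous real linear map. -/
noncomputable def ofRealCLM (n : ℕ) : Amb n →L[ℝ] CVec n :=
  LinearMap.toContinuousLinearMap
    { toFun := ofReal
      map_add' := fun v w => by simp [ofReal]
      map_smul' := fun c V => by ext k <;> simp [ofReal] }

/-- The form `g` as a continuous real bilinear map. -/
noncomputable def gCLM (n : ℕ) : CVec n →L[ℝ] CVec n →L[ℝ] ℂ :=
  (LinearMap.mk₂ ℝ g g_add_left (fun c V W => by simpa using g_smul_left (c : ℂ) V W)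
    g_add_right (fun c V W => by simpa using g_smul_right (c : ℂ) V W)).toContinuousBilinearMap

/-- Scalar multiplication as a continuous real bilinear map. -/
noncomputable def smulCLM (n : ℕ) : ℂ →L[ℝ] CVec n →L[ℝ] CVec n :=
  (LinearMap.mk₂ ℝ (fun (c : ℂ) (V : CVec n) => c • V) (fun c d V => add_smul c d V)
    (fun c d V => smul_assoc c d V) (fun c V W => smul_add c V W)
    (fun c d V => smul_comm d c V)).toContinuousBilinearMap

end Algebra

/-! ### Derivatives along a hypersurface -/

section Calculus

variable {n : ℕ} {M : Set (Amb n)} {p : Amb n}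
-- A derivative within `M` is determined on the tangent cone only, hence by linearity on its span.
-- Outside that span `fderivWithin` is an arbitrary choice, which is why the rules below ask for
-- tangential directions.
theorem fderivWithin_apply_of_mem_tangentSpace {E : Type*} [NormedAddCommGroup E]
    [NormedSpace ℝ E] {f : Amb n → E} {f' : Amb n →L[ℝ] E}
    (h : HasFDerivWithinAt f f' M p) {v : Amb n} (hv : v ∈ tangentSpace M p) :
    fderivWithin ℝ f M p v = f' v :=
  LinearMap.eqOn_span (f := (fderivWithin ℝ f M p).toLinearMap) (g := f'.toLinearMap)
    (h.differentiableWithinAt.hasFDerivWithinAt.unique_on h) hv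

variable {E F G : Type*} [NormedAddCommGroup E] [NormedSpace ℝ E] [Module ℂ E]
  [NormedAddCommGroup F] [NormedSpace ℝ F] [Module ℂ F]
  [NormedAddCommGroup G] [NormedSpace ℝ G] [Module ℂ G]

theorem conj_mem_complexTangent {V : CVec n} (hV : V ∈ complexTangent M p) :
    conj V ∈ complexTangent M p := by
  refine ⟨?_, ?_⟩
  · rw [re_conj]; exact hV.1
  · rw [im_conj]; exact neg_mem hV.2

theorem D_eq_of_hasFDerivWithinAt {f : Amb n → E} {f' : Amb n →L[ℝ] E}
    (h : HasFDerivWithinAt f f' M p) {X : CVec n} (hX : X ∈ complexTangent M p) :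
    D M f p X = f' (re X) + Complex.I • f' (im X) := by
  rw [D, fderivWithin_apply_of_mem_tangentSpace h hX.1,
    fderivWithin_apply_of_mem_tangentSpace h hX.2]

theorem D_add_dir (f : Amb n → E) (X Y : CVec n) : D M f p (X + Y) = D M f p X + D M f p Y := by
  simp only [D, re_add, im_add, map_add, smul_add]
  abel

theorem D_I_smul_dir (f : Amb n → E) (X : CVec n) :
    D M f p (Complex.I • X) = Complex.I • D M f p X := by
  simp only [D, re_I_smul, im_I_smul, map_neg, smul_add, smul_smul, Complex.I_mul_I, neg_smul,
    one_smul]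
  abel

theorem D_smul_dir (f : Amb n → CVec n) (c : ℂ) (X : CVec n) :
    D M f p (c • X) = c • D M f p X := by
  have hr : ∀ (r : ℝ) (Y : CVec n), D M f p (r • Y) = r • D M f p Y := fun r Y => by
    simp only [D, re_real_smul, im_real_smul, map_smul, smul_add]
    rw [smul_comm r Complex.I]
  rw [smul_eq_re_im c X, D_add_dir, D_I_smul_dir, hr, hr, ← smul_eq_re_im]

theorem D_sub_dir (f : Amb n → CVec n) (X Y : CVec n) :
    D M f p (X - Y) = D M f p X - D M f p Y := by
  rw [sub_eq_add_neg, D_add_dir, ← neg_one_smul ℂ Y, D_smul_dir, neg_one_smul, ← sub_eq_add_neg]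

theorem D_congr {f f' : Amb n → E} (hp : p ∈ M) (h : f =ᶠ[𝓝[M] p] f') (X : CVec n) :
    D M f p X = D M f' p X := by
  rw [D, D, h.fderivWithin_eq (h.eq_of_nhdsWithin hp)]

theorem D_const (c : E) (X : CVec n) : D M (fun _ => c) p X = 0 := by
  simp [D]

theorem D_add {f f' : Amb n → E} (hf : DifferentiableWithinAt ℝ f M p)
    (hf' : DifferentiableWithinAt ℝ f' M p) {X : CVec n} (hX : X ∈ complexTangent M p) :
    D M (fun q => f q + f' q) p X = D M f p X + D M f' p X := by
  refine (D_eq_of_hasFDerivWithinAt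
    (hf.hasFDerivWithinAt.add hf'.hasFDerivWithinAt) hX).trans ?_
  simp only [D, add_apply, smul_add]
  abel

/-- `D` is extended to complex directions through multiplication by `i`, so a real linear map
commutes with it only if it also commutes with `i`. -/
theorem D_linear (L : E →L[ℝ] F) (hL : ∀ x, L (Complex.I • x) = Complex.I • L x)
    {f : Amb n → E} (hf : DifferentiableWithinAt ℝ f M p) {X : CVec n}
    (hX : X ∈ complexTangent M p) : D M (fun q => L (f q)) p X = L (D M f p X) := by
  refine (D_eq_of_hasFDerivWithinAt
    (L.hasFDerivAt.comp_hasFDerivWithinAt p hf.hasFDerivWithinAt) hX).trans ?_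
  simp [D, hL]

theorem D_bilinear (B : E →L[ℝ] F →L[ℝ] G)
    (hB₁ : ∀ x y, B (Complex.I • x) y = Complex.I • B x y)
    (hB₂ : ∀ x y, B x (Complex.I • y) = Complex.I • B x y)
    {f : Amb n → E} {f' : Amb n → F} (hf : DifferentiableWithinAt ℝ f M p)
    (hf' : DifferentiableWithinAt ℝ f' M p) {X : CVec n} (hX : X ∈ complexTangent M p) :
    D M (fun q => B (f q) (f' q)) p X = B (D M f p X) (f' p) + B (f p) (D M f' p X) := by
  rw [D_eq_of_hasFDerivWithinAt
    (B.hasFDerivWithinAt_of_bilinear hf.hasFDerivWithinAt hf'.hasFDerivWithinAt) hX, D, D]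
  simp only [add_apply, ContinuousLinearMap.precompR_apply, ContinuousLinearMap.precompL_apply,
    ContinuousLinearMap.compL_apply, ContinuousLinearMap.comp_apply, map_add, smul_add, hB₁, hB₂]
  abel

theorem D_g {U V : Amb n → CVec n} (hU : DifferentiableWithinAt ℝ U M p)
    (hV : DifferentiableWithinAt ℝ V M p) {X : CVec n} (hX : X ∈ complexTangent M p) :
    D M (fun q => g (U q) (V q)) p X = g (D M U p X) (V p) + g (U p) (D M V p X) :=
  D_bilinear (gCLM n) (fun x y => g_smul_left _ x y) (fun x y => g_smul_right _ x y) hU hV hX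

theorem D_smul {f : Amb n → ℂ} {V : Amb n → CVec n} (hf : DifferentiableWithinAt ℝ f M p)
    (hV : DifferentiableWithinAt ℝ V M p) {X : CVec n} (hX : X ∈ complexTangent M p) :
    D M (fun q => f q • V q) p X = D M f p X • V p + f p • D M V p X :=
  D_bilinear (smulCLM n) (fun x y => smul_assoc _ x y) 
    (fun x y => smul_comm x Complex.I y) hf hV hX

theorem D_J {V : Amb n → CVec n} (hV : DifferentiableWithinAt ℝ V M p) {X : CVec n}
    (hX : X ∈ complexTangent M p) : D M (fun q => J (V q)) p X = J (D M V p X) :=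
  D_linear (LinearMap.toContinuousLinearMap ((JLin n).restrictScalars ℝ))
    (fun x => J_smul _ x) hV hX

theorem differentiableWithinAt_g {U V : Amb n → CVec n}
    (hU : DifferentiableWithinAt ℝ U M p) (hV : DifferentiableWithinAt ℝ V M p) :
    DifferentiableWithinAt ℝ (fun q => g (U q) (V q)) M p :=
  ((gCLM n).hasFDerivWithinAt_of_bilinear hU.hasFDerivWithinAt
    hV.hasFDerivWithinAt).differentiableWithinAt

theorem differentiableWithinAt_smul {f : Amb n → ℂ} {V : Amb n → CVec n}
    (hf : DifferentiableWithinAt ℝ f M p) (hV : DifferentiableWithinAt ℝ V M p) :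
    DifferentiableWithinAt ℝ (fun q => f q • V q) M p :=
  ((smulCLM n).hasFDerivWithinAt_of_bilinear hf.hasFDerivWithinAt
    hV.hasFDerivWithinAt).differentiableWithinAt

theorem differentiableWithinAt_J {V : Amb n → CVec n}
    (hV : DifferentiableWithinAt ℝ V M p) : DifferentiableWithinAt ℝ (fun q => J (V q)) M p :=
  (LinearMap.toContinuousLinearMap
    ((JLin n).restrictScalars ℝ)).differentiableAt.comp_differentiableWithinAt p hV

/-- The complex linear extension of the derivative at `p` of a function on the ambient space. -/
noncomputable def ambD (f : Amb n → E) (p : Amb n) (X : CVec n) : E :=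
  fderiv ℝ f p (re X) + Complex.I • fderiv ℝ f p (im X)

theorem D_eq_ambD {f f' : Amb n → E} (hp : p ∈ M) (hf' : DifferentiableAt ℝ f' p)
    (h : f =ᶠ[𝓝[M] p] f') {X : CVec n} (hX : X ∈ complexTangent M p) :
    D M f p X = ambD f' p X := by
  rw [D, ambD, fderivWithin_eq_of_extension hp hf' h hX.1,
    fderivWithin_eq_of_extension hp hf' h hX.2]

/-- The complex bilinear extension of the second derivative at `p`. -/
noncomputable def ambHess (f : Amb n → E) (p : Amb n) (X Y : CVec n) : E :=
  fderiv ℝ (fderiv ℝ f) p (re X) (re Y) + Complex.I • fderiv ℝ (fderiv ℝ f) p (re X) (im Y) +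
    Complex.I • (fderiv ℝ (fderiv ℝ f) p (im X) (re Y) +
      Complex.I • fderiv ℝ (fderiv ℝ f) p (im X) (im Y))

/-- Symmetry of the real second derivative survives complex bilinear extension. This is where
flatness of the ambient connection enters. -/
theorem ambHess_comm {f : Amb n → E} (hf : ContDiffAt ℝ ∞ f p) (X Y : CVec n) :
    ambHess f p X Y = ambHess f p Y X := by
  have h : IsSymmSndFDerivAt ℝ f p := hf.isSymmSndFDerivAt (by simp; norm_cast)
  simp only [ambHess, smul_add]
  rw [h (re X) (re Y), h (re X) (im Y), h (im X) (re Y), h (im X) (im Y)]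
  abel

theorem ambD_sub (f : Amb n → E) (X Y : CVec n) : ambD f p (X - Y) = ambD f p X - ambD f p Y := by
  simp only [ambD, ← reCLM_apply, ← imCLM_apply, map_sub, smul_sub]
  abel

end Calculus

/-! ### Second derivatives: differentiating `ambD f q (V q)` along `M`. -/

section SecondOrder

variable {n : ℕ} {M : Set (Amb n)} {p : Amb n}
variable {E : Type*} [NormedAddCommGroup E] [NormedSpace ℝ E] [NormedSpace ℂ E]
  [SMulCommClass ℝ ℂ E]

theorem D_ambD {f : Amb n → E} (hf : ContDiffAt ℝ ∞ f p) {V : Amb n → CVec n}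
    (hV : DifferentiableWithinAt ℝ V M p) {X : CVec n} (hX : X ∈ complexTangent M p) :
    D M (fun q => ambD f q (V q)) p X = ambHess f p X (V p) + ambD f p (D M V p X) := by
  have hf2 : HasFDerivWithinAt (fderiv ℝ f) (fderiv ℝ (fderiv ℝ f) p) M p :=
    ((hf.fderiv_right (m := 1) (by norm_cast)).differentiableAt
      (by simp)).hasFDerivAt.hasFDerivWithinAt
  have h1 := hf2.clm_apply ((reCLM n).hasFDerivAt.comp_hasFDerivWithinAt p hV.hasFDerivWithinAt)
  have h2 := hf2.clm_apply ((imCLM n).hasFDerivAt.comp_hasFDerivWithinAt p hV.hasFDerivWithinAt)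
  have h3 := h1.add (h2.const_smul Complex.I)
  have h4 : D M (fun q => ambD f q (V q)) p X = _ := D_eq_of_hasFDerivWithinAt h3 hX
  rw [h4]
  simp only [ambHess, ambD, D, re_add, im_add, re_I_smul, im_I_smul, map_add, map_neg,
    add_apply, ContinuousLinearMap.comp_apply, ContinuousLinearMap.flip_apply,
    smul_apply, reCLM_apply, imCLM_apply, smul_add, Function.comp,
    smul_smul, Complex.I_mul_I, neg_smul, one_smul]
  abel

theorem differentiableWithinAt_ambD {f : Amb n → E} (hf : ContDiffAt ℝ ∞ f p)
    {V : Amb n → CVec n} (hV : DifferentiableWithinAt ℝ V M p) :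
    DifferentiableWithinAt ℝ (fun q => ambD f q (V q)) M p := by
  have hf2 : DifferentiableWithinAt ℝ (fderiv ℝ f) M p :=
    ((hf.fderiv_right (m := 1) (by norm_cast)).differentiableAt (by simp)).differentiableWithinAt
  exact (hf2.clm_apply ((reCLM n).differentiableAt.comp_differentiableWithinAt p hV)).add
    ((hf2.clm_apply ((imCLM n).differentiableAt.comp_differentiableWithinAt p hV)).const_smul
      Complex.I)

end SecondOrder

/-! ### The tangent space and the symmetry of the second fundamental form -/

section Geometry

variable {n : ℕ} {M O : Set (Amb n)} {p : Amb n} {ν : Amb n → Amb n}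

/-- The implicit function theorem parametrises `M` near `p` by the kernel of the differential of
`F`, so every kernel vector is a velocity of `M`. -/
theorem mem_tangentSpace_of_fderiv_eq_zero {U : Set (Amb n)} (hU : IsOpen U) (hpU : p ∈ U)
    {F : Amb n → ℝ} (hF : ContDiffOn ℝ ∞ F U) (hM : ∀ q ∈ U, q ∈ M ↔ F q = 0) (hp : p ∈ M)
    (h0 : fderiv ℝ F p ≠ 0) {v : Amb n} (hv : fderiv ℝ F p v = 0) : v ∈ tangentSpace M p := by
  have hs : HasStrictFDerivAt F (fderiv ℝ F p) p :=
    (hF.contDiffAt (hU.mem_nhds hpU)).hasStrictFDerivAt (by simp)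
  have hr : (fderiv ℝ F p).range = ⊤ := by
    refine LinearMap.range_eq_top.2 (LinearMap.surjective ?_)
    intro h
    exact h0 (ContinuousLinearMap.coe_injective h)
  set φ := hs.implicitFunction F (fderiv ℝ F p) hr (F p) with hφ
  have hFp : F p = 0 := (hM p hpU).1 hp
  have hφ0 : φ 0 = p := hs.implicitFunction_apply_image hr
  have hd : HasFDerivAt φ (fderiv ℝ F p).ker.subtypeL 0 := (hs.to_implicitFunction hr).hasFDerivAt
  have h1 : ∀ᶠ y in 𝓝 (0 : (fderiv ℝ F p).ker), F (φ y) = F p :=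
    (Continuous.prodMk_right (F p)).continuousAt.eventually (hs.map_implicitFunction_eq hr)
  have h2 : ∀ᶠ y in 𝓝 (0 : (fderiv ℝ F p).ker), φ y ∈ U :=
    hd.continuousAt.eventually (by rw [hφ0]; exact hU.mem_nhds hpU)
  have h3 : {y | φ y ∈ M} ∈ 𝓝 (0 : (fderiv ℝ F p).ker) := by
    filter_upwards [h1, h2] with y hy1 hy2
    exact (hM _ hy2).2 (hy1.trans hFp)
  -- The derivative of `φ` at `0` is the inclusion of the kernel, and `φ` maps a whole neighbourhood
  -- of `0` into `M`; the tangent cone of that neighbourhood is everything.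
  have h4 := (hd.hasFDerivWithinAt (s := {y | φ y ∈ M})).mapsTo_tangent_cone
  rw [tangentConeAt_of_mem_nhds h3, hφ0] at h4
  have h5 := h4 (Set.mem_univ (⟨v, hv⟩ : (fderiv ℝ F p).ker))
  exact Submodule.subset_span (tangentConeAt_mono (Set.image_subset_iff.2 fun y hy => hy) h5)

/-- If `F` is a defining function, the unit normal is proportional to its gradient. -/
theorem normal_mul_fderiv (hν : IsUnitNormalOn M O ν) {U : Set (Amb n)} (hU : IsOpen U)
    {F : Amb n → ℝ} (hF : ContDiffOn ℝ ∞ F U) (hM : ∀ q ∈ U, q ∈ M ↔ F q = 0)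
    (h0 : ∀ q ∈ M ∩ U, fderiv ℝ F q ≠ 0) (hp : p ∈ M ∩ O) (hpU : p ∈ U) (v : Amb n) :
    fderiv ℝ F p (ν p) ≠ 0 ∧
      g (ofReal v) (ofReal (ν p)) * (fderiv ℝ F p (ν p) : ℂ) = (fderiv ℝ F p v : ℂ) := by
  have hne : fderiv ℝ F p (ν p) ≠ 0 := by
    intro h
    have := hν.normal p hp _ (mem_tangentSpace_of_fderiv_eq_zero hU hpU hF hM hp.1
      (h0 p ⟨hp.1, hpU⟩) h)
    rw [hν.unit p hp] at this
    exact one_ne_zero this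
  refine ⟨hne, ?_⟩
  -- The constant is chosen so that `v - c ν` is annihilated by `dF`, hence tangent, hence
  -- orthogonal to `ν`.
  set c : ℝ := fderiv ℝ F p v / fderiv ℝ F p (ν p) with hc
  have hker : fderiv ℝ F p (v - c • ν p) = 0 := by
    rw [map_sub, map_smul, smul_eq_mul, hc, div_mul_cancel₀ _ hne, sub_self]
  have h1 := hν.normal p hp _ (mem_tangentSpace_of_fderiv_eq_zero hU hpU hF hM hp.1
    (h0 p ⟨hp.1, hpU⟩) hker)
  have h2 : ofReal (v - c • ν p) = ofReal v - (c : ℂ) • ofReal (ν p) := by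
    ext k <;> simp [ofReal]
  rw [h2, g_sub_right, g_smul_right, hν.unit p hp, g_comm] at h1
  have h3 : g (ofReal v) (ofReal (ν p)) = c := by linear_combination h1
  rw [h3, hc]
  push_cast
  exact div_mul_cancel₀ _ (by exact_mod_cast hne)

/-- `g` is real on real vectors, so the real and imaginary parts of `V` contribute separately. -/
theorem g_eq_zero_iff (V : CVec n) (w : Amb n) :
    g V (ofReal w) = 0 ↔
      g (ofReal (re V)) (ofReal w) = 0 ∧ g (ofReal (im V)) (ofReal w) = 0 := by
  conv_lhs => rw [← ofReal_re_add_im V, g_add_left, g_smul_left]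
  rw [g_ofReal, g_ofReal]
  simp only [Complex.ext_iff]
  simp

/-- The complexified tangent space is the orthogonal complement of the normal. -/
theorem mem_complexTangent_iff (hM : IsRealHypersurface M) (hν : IsUnitNormalOn M O ν)
    (hp : p ∈ M ∩ O) {V : CVec n} : V ∈ complexTangent M p ↔ g V (ofReal (ν p)) = 0 := by
  obtain ⟨U, hU, hpU, F, hF, hMF, h0⟩ := hM p hp.1
  have key : ∀ v, g (ofReal v) (ofReal (ν p)) = 0 → v ∈ tangentSpace M p := fun v hv => by
    have := (normal_mul_fderiv hν hU hF hMF h0 hp hpU v).2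
    rw [hv, zero_mul] at this
    exact mem_tangentSpace_of_fderiv_eq_zero hU hpU hF hMF hp.1 (h0 p ⟨hp.1, hpU⟩)
      (by exact_mod_cast this.symm)
  have key' : ∀ v ∈ tangentSpace M p, g (ofReal v) (ofReal (ν p)) = 0 := fun v hv => by
    rw [g_comm]; exact hν.normal p hp v hv
  rw [g_eq_zero_iff]
  exact ⟨fun h => ⟨key' _ h.1, key' _ h.2⟩, fun h => ⟨key _ h.1, key _ h.2⟩⟩

theorem eventually_mem (hO : IsOpen O) (hp : p ∈ M ∩ O) : ∀ᶠ q in 𝓝[M] p, q ∈ M ∩ O := by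
  filter_upwards [self_mem_nhdsWithin, mem_nhdsWithin_of_mem_nhds (hO.mem_nhds hp.2)] with q h1 h2
  exact ⟨h1, h2⟩

theorem SmoothOn.differentiableWithinAt {E : Type*} [NormedAddCommGroup E] [NormedSpace ℝ E]
    {f : Amb n → E} (hf : SmoothOn (M ∩ O) f) (hO : IsOpen O) (hp : p ∈ M ∩ O) :
    DifferentiableWithinAt ℝ f M p := by
  obtain ⟨U, hU, hpU, f', hf', h⟩ := hf p hp
  refine (((hf'.contDiffAt (hU.mem_nhds hpU)).differentiableAt
    (by simp)).differentiableWithinAt (s := M)).congr_of_eventuallyEq ?_ (h p ⟨hp, hpU⟩)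
  filter_upwards [eventually_mem hO hp, mem_nhdsWithin_of_mem_nhds (hU.mem_nhds hpU)] with q h1 h2
  exact h q ⟨h1, h2⟩

theorem differentiableWithinAt_ofReal_normal (hν : IsUnitNormalOn M O ν) (hO : IsOpen O)
    (hp : p ∈ M ∩ O) : DifferentiableWithinAt ℝ (fun q => ofReal (ν q)) M p :=
  (ofRealCLM n).differentiableAt.comp_differentiableWithinAt p
    (hν.smooth.differentiableWithinAt hO hp)

/-- The second fundamental form is symmetric. -/
theorem sff_comm (hM : IsRealHypersurface M) (hO : IsOpen O) (hν : IsUnitNormalOn M O ν)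
    (hp : p ∈ M ∩ O) {V W : CVec n} (hV : V ∈ complexTangent M p) (hW : W ∈ complexTangent M p) :
    sff M ν p V W = sff M ν p W V := by
  obtain ⟨U, hU, hpU, F, hF, hMF, h0⟩ := hM p hp.1
  set f : Amb n → ℂ := fun q => (F q : ℂ) with hf
  have hfs : ∀ q ∈ U, ContDiffAt ℝ ∞ f q := fun q hq =>
    Complex.ofRealCLM.contDiff.contDiffAt.comp q (hF.contDiffAt (hU.mem_nhds hq))
  have hfd : ∀ q ∈ U, ∀ v, fderiv ℝ f q v = (fderiv ℝ F q v : ℂ) := fun q hq v => by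
    have : HasFDerivAt f (Complex.ofRealCLM.comp (fderiv ℝ F q)) q :=
      Complex.ofRealCLM.hasFDerivAt.comp q
        ((hF.contDiffAt (hU.mem_nhds hq)).differentiableAt (by simp)).hasFDerivAt
    rw [this.fderiv]
    rfl
  have hpr : ∀ q ∈ M ∩ O, q ∈ U → ∀ X, g X (ofReal (ν q)) * ambD f q (ofReal (ν q)) = ambD f q X := by
    intro q hq hqU X
    conv_lhs => rw [← ofReal_re_add_im X, g_add_left, g_smul_left]
    have h1 := (normal_mul_fderiv hν hU hF hMF h0 hq hqU (re X)).2
    have h2 := (normal_mul_fderiv hν hU hF hMF h0 hq hqU (im X)).2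
    simp only [ambD, re_ofReal, im_ofReal, map_zero, smul_eq_mul, mul_zero, add_zero, hfd q hqU,
      Complex.ofReal_zero]
    linear_combination h1 + Complex.I * h2
  have hdν := differentiableWithinAt_ofReal_normal hν hO hp
  have hdc : ∀ X : CVec n, DifferentiableWithinAt ℝ (fun _ : Amb n => X) M p := fun X =>
    differentiableWithinAt_const X
  have hda : DifferentiableWithinAt ℝ (fun q => ambD f q (ofReal (ν q))) M p := by
    have h2 : DifferentiableWithinAt ℝ (fderiv ℝ f) M p :=
      (((hfs p hpU).fderiv_right (m := 1) (by norm_cast)).differentiableAt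
        (by simp)).differentiableWithinAt
    simp only [ambD, re_ofReal, im_ofReal, map_zero, smul_zero, add_zero]
    exact h2.clm_apply (hν.smooth.differentiableWithinAt hO hp)
  have main : ∀ X Y, X ∈ complexTangent M p → Y ∈ complexTangent M p →
      sff M ν p X Y * ambD f p (ofReal (ν p)) = ambHess f p Y X := by
    intro X Y hX hY
    -- The identity `g(X, ν) dF(ν) = dF(X)` along `M` is differentiated in the direction `Y` with
    -- `X` held constant. Since `g(X, ν) = 0` at `p`, the derivative of `dF(ν)` drops out and `h(X,
    -- Y) dF(ν)` equals the Hessian.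
    have e1 : D M (fun q => g X (ofReal (ν q)) * ambD f q (ofReal (ν q))) p Y =
        D M (fun q => ambD f q X) p Y := by
      refine D_congr hp.1 ?_ Y
      filter_upwards [eventually_mem hO hp, mem_nhdsWithin_of_mem_nhds (hU.mem_nhds hpU)] with q h1 h2
      exact hpr q h1 h2 X
    rw [D_ambD (hfs p hpU) (hdc X) hY, D_const] at e1
    have e2 : D M (fun q => g X (ofReal (ν q)) * ambD f q (ofReal (ν q))) p Y = _ :=
      D_bilinear (ContinuousLinearMap.mul ℝ ℂ) (fun x y => by simp [mul_assoc])
        (fun x y => by simp [mul_left_comm]) (differentiableWithinAt_g (hdc X) hdν) hda hY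
    rw [D_g (hdc X) hdν hY, D_const, (mem_complexTangent_iff hM hν hp).1 hX] at e2
    simp only [ContinuousLinearMap.mul_apply', zero_mul, add_zero] at e2
    rw [e1] at e2
    have e3 : g (0 : CVec n) (ofReal (ν p)) = 0 := by rw [g_comm, g_zero_right]
    have e4 : ambD f p (0 : CVec n) = 0 := by
      have : (0 : CVec n) = ofReal 0 := by ext k <;> simp [ofReal]
      rw [this, ambD, re_ofReal, im_ofReal]; simp
    rw [e3, zero_add, e4, add_zero] at e2
    exact e2.symm
  have hne : ambD f p (ofReal (ν p)) ≠ 0 := by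
    simp only [ambD, re_ofReal, im_ofReal, map_zero, smul_zero, add_zero, hfd p hpU,
      Complex.ofReal_zero]
    exact_mod_cast (normal_mul_fderiv hν hU hF hMF h0 hp hpU 0).1
  refine mul_right_cancel₀ hne ?_
  rw [main V W hV hW, main W V hW hV, ambHess_comm (hfs p hpU)]

/-- Differentiate `g(ν, ν) = 1`. Equivalently, `D_X ν` is tangent. -/
theorem sff_normal_eq_zero (hO : IsOpen O) (hν : IsUnitNormalOn M O ν)
    (hp : p ∈ M ∩ O) {X : CVec n} (hX : X ∈ complexTangent M p) :
    sff M ν p (ofReal (ν p)) X = 0 := by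
  have hdν := differentiableWithinAt_ofReal_normal hν hO hp
  have h1 := D_g hdν hdν hX
  have h2 : D M (fun q => g (ofReal (ν q)) (ofReal (ν q))) p X = D M (fun _ => (1 : ℂ)) p X := by
    refine D_congr hp.1 ?_ X
    filter_upwards [eventually_mem hO hp] with q h
    exact hν.unit q h
  rw [h2, D_const, g_comm] at h1
  simp only [sff]
  linear_combination -h1 / 2

/-- `D_X V` has normal component `-h(V, X)` for tangent fields `V`. -/
theorem g_D_normal (hO : IsOpen O) (hν : IsUnitNormalOn M O ν)
    (hp : p ∈ M ∩ O) {V : Amb n → CVec n} (hV : DifferentiableWithinAt ℝ V M p)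
    (hVt : ∀ q ∈ M ∩ O, g (V q) (ofReal (ν q)) = 0) {X : CVec n} (hX : X ∈ complexTangent M p) :
    g (D M V p X) (ofReal (ν p)) = -sff M ν p (V p) X := by
  have h1 := D_g hV (differentiableWithinAt_ofReal_normal hν hO hp) hX
  have h2 : D M (fun q => g (V q) (ofReal (ν q))) p X = D M (fun _ => (0 : ℂ)) p X := by
    refine D_congr hp.1 ?_ X
    filter_upwards [eventually_mem hO hp] with q h
    exact hVt q h
  rw [h2, D_const] at h1
  simp only [sff]
  linear_combination -h1

/-- The Codazzi equation of the flat ambient space. -/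
theorem D_sff_sub_D_sff (hM : IsRealHypersurface M) (hO : IsOpen O) (hν : IsUnitNormalOn M O ν)
    (hp : p ∈ M ∩ O) {X U V : Amb n → CVec n}
    (hX : DifferentiableWithinAt ℝ X M p) (hU : DifferentiableWithinAt ℝ U M p)
    (hV : DifferentiableWithinAt ℝ V M p)
    (hXt : ∀ q ∈ M ∩ O, g (X q) (ofReal (ν q)) = 0)
    (hVt : ∀ q ∈ M ∩ O, g (V q) (ofReal (ν q)) = 0) :
    D M (fun q => sff M ν q (U q) (V q)) p (X p) - D M (fun q => sff M ν q (U q) (X q)) p (V p) =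
      sff M ν p (D M U p (X p)) (V p) - sff M ν p (D M U p (V p)) (X p) +
        sff M ν p (U p) (D M V p (X p) - D M X p (V p)) := by
  obtain ⟨W, hW, hpW, ν', hν', hext⟩ := hν.smooth p hp
  set f : Amb n → CVec n := fun q => ofReal (ν' q) with hf
  have hfs : ∀ q ∈ W, ContDiffAt ℝ ∞ f q := fun q hq =>
    (ofRealCLM n).contDiff.contDiffAt.comp q (hν'.contDiffAt (hW.mem_nhds hq))
  have hDe : ∀ q ∈ M ∩ O, q ∈ W → ∀ Y ∈ complexTangent M q,
      D M (fun q => ofReal (ν q)) q Y = ambD f q Y := by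
    intro q hq hqW Y hY
    refine D_eq_ambD hq.1 ((hfs q hqW).differentiableAt (by simp)) ?_ hY
    filter_upwards [eventually_mem hO hq, mem_nhdsWithin_of_mem_nhds (hW.mem_nhds hqW)] with x h1 h2
    rw [hf, hext x ⟨h1, h2⟩]
  -- With `ν` replaced by its ambient extension, the product rule separates a Hessian term,
  -- symmetric in the two directions, from the derivatives of `U` and `Y`.
  have key : ∀ Y Y' : Amb n → CVec n, DifferentiableWithinAt ℝ Y M p →
      (∀ q ∈ M ∩ O, g (Y q) (ofReal (ν q)) = 0) → Y' p ∈ complexTangent M p →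
      D M (fun q => sff M ν q (U q) (Y q)) p (Y' p) =
        sff M ν p (D M U p (Y' p)) (Y p) +
          g (U p) (ambHess f p (Y' p) (Y p) + ambD f p (D M Y p (Y' p))) := by
    intro Y Y' hY hYt hY't
    have hYp := (mem_complexTangent_iff hM hν hp).2 (hYt p hp)
    have e1 : D M (fun q => sff M ν q (U q) (Y q)) p (Y' p) =
        D M (fun q => g (U q) (ambD f q (Y q))) p (Y' p) := by
      refine D_congr hp.1 ?_ _
      filter_upwards [eventually_mem hO hp, mem_nhdsWithin_of_mem_nhds (hW.mem_nhds hpW)]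
        with q h1 h2
      rw [sff, hDe q h1 h2 _ ((mem_complexTangent_iff hM hν h1).2 (hYt q h1))]
    rw [e1, D_g hU (differentiableWithinAt_ambD (hfs p hpW) hY) hY't,
      D_ambD (hfs p hpW) hY hY't, sff, hDe p hp hpW _ hYp]
  have hXp := (mem_complexTangent_iff hM hν hp).2 (hXt p hp)
  have hVp := (mem_complexTangent_iff hM hν hp).2 (hVt p hp)
  -- `D` on `M` agrees with the ambient derivative in tangential directions only, so the bracket
  -- must be shown tangent before `D ν` can be evaluated on it.
  have hbr : D M V p (X p) - D M X p (V p) ∈ complexTangent M p := by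
    rw [mem_complexTangent_iff hM hν hp, g_sub_left, g_D_normal hO hν hp hV hVt hXp,
      g_D_normal hO hν hp hX hXt hVp, sff_comm hM hO hν hp hXp hVp, sub_self]
  rw [key V X hV hVt hXp, key X V hX hXt hVp, ambHess_comm (hfs p hpW) (V p) (X p), sff, sff, sff,
    hDe p hp hpW _ hbr, ambD_sub, g_sub_right, g_add_right, g_add_right]
  ring

end Geometry

/-! ### The difference of `D` and `∇`, and the Codazzi identity for tangent fields. -/

section Connection

variable {n : ℕ} {M O : Set (Amb n)} {p : Amb n} {ν : Amb n → Amb n}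

theorem sff_add_left (U U' V : CVec n) :
    sff M ν p (U + U') V = sff M ν p U V + sff M ν p U' V := g_add_left _ _ _

theorem sff_sub_left (U U' V : CVec n) :
    sff M ν p (U - U') V = sff M ν p U V - sff M ν p U' V := g_sub_left _ _ _

theorem sff_smul_left (c : ℂ) (U V : CVec n) : sff M ν p (c • U) V = c * sff M ν p U V :=
  g_smul_left _ _ _

theorem sff_zero_left (V : CVec n) : sff M ν p 0 V = 0 := by
  rw [sff, g_comm, g_zero_right]

theorem sff_sub_right (U V V' : CVec n) :
    sff M ν p U (V - V') = sff M ν p U V - sff M ν p U V' := by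
  rw [sff, D_sub_dir, g_sub_right]
  rfl

/-- The projection of complexified vectors to type `(1, 0)`. -/
noncomputable def holCLM (n : ℕ) : CVec n →L[ℝ] CVec n :=
  (ContinuousLinearMap.fst ℝ (Amb n) (Amb n)).prod 0

/-- The projection of complexified vectors to type `(0, 1)`. -/
noncomputable def antiholCLM (n : ℕ) : CVec n →L[ℝ] CVec n :=
  (0 : CVec n →L[ℝ] Amb n).prod (ContinuousLinearMap.snd ℝ (Amb n) (Amb n))

theorem J_mk_zero (a : Amb n) : J ((a, 0) : CVec n) = Complex.I • ((a, 0) : CVec n) := by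
  ext k <;> simp [J]

theorem J_zero_mk (b : Amb n) : J ((0, b) : CVec n) = -(Complex.I • ((0, b) : CVec n)) := by
  ext k <;> simp [J]

theorem J_eq_I_smul_iff (V : CVec n) : J V = Complex.I • V ↔ V.2 = 0 := by
  constructor
  · intro h
    have h2 : -Complex.I • V.2 = Complex.I • V.2 := congrArg Prod.snd h
    ext k
    have h3 := congrFun h2 k
    simp only [Pi.smul_apply, smul_eq_mul] at h3
    have h4 : Complex.I * V.2 k = 0 := by linear_combination -h3 / 2
    simpa using h4
  · intro h
    obtain ⟨a, b⟩ := V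
    obtain rfl : b = 0 := h
    exact J_mk_zero a

theorem J_T (q : Amb n) : J (T ν q) = -ofReal (ν q) := J_J _

theorem g_T_normal (q : Amb n) : g (T ν q) (ofReal (ν q)) = 0 := by
  rw [g_comm]; exact g_self_J _

theorem g_T_T (hν : IsUnitNormalOn M O ν) (hp : p ∈ M ∩ O) : g (T ν p) (T ν p) = 1 := by
  conv_lhs => rw [T, g_J_left, J_J, g_comm, g_neg_left, neg_neg]
  exact hν.unit p hp

theorem conj_T (q : Amb n) : conj (T ν q) = T ν q := by
  rw [T, J_ofReal, conj_ofReal]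

/-- Let `a`, `b` be the pairings of the two parts with `ν`. Tangency of `V` gives `a + b = 0`.
Removing the `T` component makes the pairings with `T`, which are `-i a` and `i b`, sum to zero.
Hence `a = b = 0`. -/
theorem g_holPart_antiholPart_normal (hν : IsUnitNormalOn M O ν) (hp : p ∈ M ∩ O) {V : Amb n → CVec n}
    (hV : g (V p) (ofReal (ν p)) = 0) :
    g (holPart ν V p) (ofReal (ν p)) = 0 ∧ g (antiholPart ν V p) (ofReal (ν p)) = 0 := by
  have h := decomposition ν V p
  have h1 : g (holPart ν V p) (T ν p) + g (antiholPart ν V p) (T ν p) = 0 := by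
    have : tPart ν V p = g (holPart ν V p) (T ν p) + g (antiholPart ν V p) (T ν p) +
        tPart ν V p := by
      conv_lhs => rw [tPart, h, g_add_left, g_add_left, g_smul_left, g_T_T hν hp, mul_one]
    linear_combination -this
  have h2 : g (holPart ν V p) (ofReal (ν p)) + g (antiholPart ν V p) (ofReal (ν p)) = 0 := by
    rw [h, g_add_left, g_add_left, g_smul_left, g_T_normal] at hV
    linear_combination hV
  have h3 : g (holPart ν V p) (T ν p) = -Complex.I * g (holPart ν V p) (ofReal (ν p)) := by
    have := g_J_left (holPart ν V p) (ofReal (ν p))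
    rw [holPart, J_mk_zero, g_smul_left, ← holPart] at this
    rw [T]
    linear_combination this
  have h4 : g (antiholPart ν V p) (T ν p) = Complex.I * g (antiholPart ν V p) (ofReal (ν p)) := by
    have := g_J_left (antiholPart ν V p) (ofReal (ν p))
    rw [antiholPart, J_zero_mk, g_neg_left, g_smul_left, ← antiholPart] at this
    rw [T]
    linear_combination this
  rw [h3, h4] at h1
  constructor
  · linear_combination h2 / 2 + Complex.I / 2 * h1 -
      (g (antiholPart ν V p) (ofReal (ν p)) - g (holPart ν V p) (ofReal (ν p))) / 2 *
        Complex.I_sq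
  · linear_combination h2 / 2 - Complex.I / 2 * h1 +
      (g (antiholPart ν V p) (ofReal (ν p)) - g (holPart ν V p) (ofReal (ν p))) / 2 *
        Complex.I_sq

theorem differentiableWithinAt_T (hO : IsOpen O) (hν : IsUnitNormalOn M O ν) (hp : p ∈ M ∩ O) :
    DifferentiableWithinAt ℝ (T ν) M p :=
  differentiableWithinAt_J (differentiableWithinAt_ofReal_normal hν hO hp)

theorem differentiableWithinAt_tPart (hO : IsOpen O) (hν : IsUnitNormalOn M O ν) (hp : p ∈ M ∩ O)
    {V : Amb n → CVec n} (hV : DifferentiableWithinAt ℝ V M p) :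
    DifferentiableWithinAt ℝ (tPart ν V) M p :=
  differentiableWithinAt_g hV (differentiableWithinAt_T hO hν hp)

theorem differentiableWithinAt_holPart (hO : IsOpen O) (hν : IsUnitNormalOn M O ν)
    (hp : p ∈ M ∩ O) {V : Amb n → CVec n} (hV : DifferentiableWithinAt ℝ V M p) :
    DifferentiableWithinAt ℝ (holPart ν V) M p :=
  (holCLM n).differentiableAt.comp_differentiableWithinAt p
    (hV.sub (differentiableWithinAt_smul (differentiableWithinAt_tPart hO hν hp hV)
      (differentiableWithinAt_T hO hν hp)))

theorem differentiableWithinAt_antiholPart (hO : IsOpen O) (hν : IsUnitNormalOn M O ν)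
    (hp : p ∈ M ∩ O) {V : Amb n → CVec n} (hV : DifferentiableWithinAt ℝ V M p) :
    DifferentiableWithinAt ℝ (antiholPart ν V) M p :=
  (antiholCLM n).differentiableAt.comp_differentiableWithinAt p
    (hV.sub (differentiableWithinAt_smul (differentiableWithinAt_tPart hO hν hp hV)
      (differentiableWithinAt_T hO hν hp)))

theorem conj_N (q : Amb n) :
    conj (N ν q) = ((Real.sqrt 2 : ℝ) : ℂ)⁻¹ • (ofReal (ν q) + Complex.I • T ν q) := by
  rw [N, conj_smul, conj_sub, conj_smul, conj_ofReal, conj_T]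
  congr 1
  · simp
  · simp

theorem inv_sqrt_two_mul_self :
    ((Real.sqrt 2 : ℝ) : ℂ)⁻¹ * ((Real.sqrt 2 : ℝ) : ℂ)⁻¹ = 1 / 2 := by
  rw [← mul_inv, ← Complex.ofReal_mul, Real.mul_self_sqrt (by norm_num)]
  norm_num

/-- If `V` is a `±i`-eigenfield of `J` orthogonal to the normal, then the component of `D_X V`
along `ν ± i T` is determined by the second fundamental form. -/
theorem g_D_eigenfield (hO : IsOpen O) (hν : IsUnitNormalOn M O ν) (hp : p ∈ M ∩ O)
    {c : ℂ} (hc : c * c = -1) {V : Amb n → CVec n} (hV : DifferentiableWithinAt ℝ V M p)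
    (hJ : ∀ q, J (V q) = c • V q) (hVt : ∀ q ∈ M ∩ O, g (V q) (ofReal (ν q)) = 0)
    {X : CVec n} (hX : X ∈ complexTangent M p) :
    g (D M V p X) (ofReal (ν p) + c • T ν p) = -2 * sff M ν p (V p) X := by
  have hJc : ∀ W : CVec n, g (V p) (J W) = -c * g (V p) W := fun W => by
    have := g_J_left (V p) W
    rw [hJ, g_smul_left] at this
    linear_combination this
  have h1 := g_D_normal hO hν hp hV hVt hX
  -- An eigenfield of `J` orthogonal to `ν` is orthogonal to `T` too. Differentiating this gives
  -- `g(D_X V, T) = c h(V, X)`; multiplied by `c` it doubles the normal contribution `-h(V, X)`,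
  -- because `c² = -1`.
  have h2 : D M (fun q => g (V q) (T ν q)) p X = D M (fun _ => (0 : ℂ)) p X := by
    refine D_congr hp.1 ?_ X
    filter_upwards [eventually_mem hO hp] with q h
    have := g_J_left (V q) (ofReal (ν q))
    rw [hJ, g_smul_left, hVt q h] at this
    rw [T]
    linear_combination this
  have hdν := differentiableWithinAt_ofReal_normal hν hO hp
  rw [D_const, D_g hV (differentiableWithinAt_T hO hν hp) hX] at h2
  have h3 : D M (T ν) p X = J (D M (fun q => ofReal (ν q)) p X) := D_J hdν hX
  rw [h3, hJc] at h2
  rw [g_add_right, g_smul_right, h1]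
  simp only [sff] at h2 ⊢
  linear_combination c * h2 + g (V p) (D M (fun q => ofReal (ν q)) p X) * hc

/-- The difference between the flat connection and `∇`. -/
theorem D_sub_nabla (hO : IsOpen O) (hν : IsUnitNormalOn M O ν) (hp : p ∈ M ∩ O)
    {X V : Amb n → CVec n} (hV : DifferentiableWithinAt ℝ V M p)
    (hVt : ∀ q ∈ M ∩ O, g (V q) (ofReal (ν q)) = 0) (hX : X p ∈ complexTangent M p) :
    D M V p (X p) - nabla M ν X V p =
      -sff M ν p (holPart ν V p) (X p) • (ofReal (ν p) - Complex.I • T ν p) -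
        sff M ν p (antiholPart ν V p) (X p) • (ofReal (ν p) + Complex.I • T ν p) +
        tPart ν V p • J (D M (fun q => ofReal (ν q)) p (X p)) := by
  have hdν := differentiableWithinAt_ofReal_normal hν hO hp
  have hdT := differentiableWithinAt_T hO hν hp
  have hdt := differentiableWithinAt_tPart hO hν hp hV
  have hdh := differentiableWithinAt_holPart hO hν hp hV
  have hda := differentiableWithinAt_antiholPart hO hν hp hV
  have e1 : D M V p (X p) = D M (holPart ν V) p (X p) + D M (antiholPart ν V) p (X p) +
      (D M (tPart ν V) p (X p) • T ν p +
        tPart ν V p • J (D M (fun q => ofReal (ν q)) p (X p))) := by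
    have h1 : V = fun q => holPart ν V q + antiholPart ν V q + tPart ν V q • T ν q :=
      funext (decomposition ν V)
    have h2 : D M (T ν) p (X p) = J (D M (fun q => ofReal (ν q)) p (X p)) := D_J hdν hX
    have h3 : DifferentiableWithinAt ℝ (fun q => holPart ν V q + antiholPart ν V q) M p :=
      hdh.add hda
    conv_lhs => rw [h1]
    rw [D_add h3 (differentiableWithinAt_smul hdt hdT) hX, D_smul hdt hdT hX, h2,
      D_add hdh hda hX]
  have e2 := g_D_eigenfield hO hν hp (c := Complex.I) Complex.I_mul_I hdh (fun q => J_mk_zero _)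
    (fun q hq => (g_holPart_antiholPart_normal hν hq (hVt q hq)).1) hX
  have e3 := g_D_eigenfield hO hν hp (c := -Complex.I) (by simp) hda
    (fun q => by rw [neg_smul]; exact J_zero_mk _)
    (fun q hq => (g_holPart_antiholPart_normal hν hq (hVt q hq)).2) hX
  rw [neg_smul, ← sub_eq_add_neg] at e3
  rw [e1, nabla, conj_N, N, g_smul_right, g_smul_right, e2, e3]
  have hs := inv_sqrt_two_mul_self
  set s := ((Real.sqrt 2 : ℝ) : ℂ)⁻¹
  -- The factor `-2` from the eigenfield computation cancels against the two factors `1/√2` in `N`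
  -- and `N̄`.
  have h4 : ∀ a : ℂ, s * (-2 * a) * s = -a := fun a => by linear_combination -2 * a * hs
  rw [smul_smul, smul_smul, h4, h4]
  module

theorem g_D_sub_nabla_normal (hO : IsOpen O) (hν : IsUnitNormalOn M O ν) (hp : p ∈ M ∩ O)
    {X V : Amb n → CVec n} (hV : DifferentiableWithinAt ℝ V M p)
    (hVt : ∀ q ∈ M ∩ O, g (V q) (ofReal (ν q)) = 0) (hX : X p ∈ complexTangent M p) :
    g (D M V p (X p) - nabla M ν X V p) (ofReal (ν p)) = -sff M ν p (V p) (X p) := by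
  have h1 : sff M ν p (V p) (X p) = sff M ν p (holPart ν V p) (X p) +
      sff M ν p (antiholPart ν V p) (X p) + tPart ν V p * sff M ν p (T ν p) (X p) := by
    conv_lhs => rw [decomposition ν V p, sff_add_left, sff_add_left, sff_smul_left]
  have h2 : g (J (D M (fun q => ofReal (ν q)) p (X p))) (ofReal (ν p)) =
      -sff M ν p (T ν p) (X p) := by
    rw [g_J_left, g_comm]; rfl
  rw [D_sub_nabla hO hν hp hV hVt hX, g_add_left, g_sub_left, g_smul_left, g_smul_left, g_smul_left,
    g_sub_left, g_add_left, g_smul_left, g_T_normal, hν.unit p hp, h2, h1]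
  ring

/-- The `ν` components of `D - ∇` disappear because `h(ν, Y) = 0`; what remains are the `T`
components and the term from `D_X T = J D_X ν`. -/
theorem sff_D_sub_nabla (hO : IsOpen O) (hν : IsUnitNormalOn M O ν) (hp : p ∈ M ∩ O)
    {X V : Amb n → CVec n} (hV : DifferentiableWithinAt ℝ V M p)
    (hVt : ∀ q ∈ M ∩ O, g (V q) (ofReal (ν q)) = 0) (hX : X p ∈ complexTangent M p)
    {Y : CVec n} (hY : Y ∈ complexTangent M p) :
    sff M ν p (D M V p (X p) - nabla M ν X V p) Y =
      Complex.I * (sff M ν p (holPart ν V p) (X p) - sff M ν p (antiholPart ν V p) (X p)) *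
        sff M ν p (T ν p) Y +
      tPart ν V p * g (J (D M (fun q => ofReal (ν q)) p (X p)))
        (D M (fun q => ofReal (ν q)) p Y) := by
  rw [D_sub_nabla hO hν hp hV hVt hX, sff_add_left, sff_sub_left, sff_smul_left, sff_smul_left,
    sff_smul_left, sff_sub_left, sff_add_left, sff_smul_left, sff_normal_eq_zero hO hν hp hY, sff,
    sff, sff, sff]
  ring

/-- `D_X V` and `D_X V - ∇_X V` have the same normal component `-h(V, X)`. -/
theorem nabla_mem_complexTangent (hM : IsRealHypersurface M) (hO : IsOpen O)
    (hν : IsUnitNormalOn M O ν) (hp : p ∈ M ∩ O) {X V : Amb n → CVec n}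
    (hV : DifferentiableWithinAt ℝ V M p) (hVt : ∀ q ∈ M ∩ O, g (V q) (ofReal (ν q)) = 0)
    (hX : X p ∈ complexTangent M p) : nabla M ν X V p ∈ complexTangent M p := by
  have h := g_D_sub_nabla_normal hO hν hp hV hVt hX
  rw [g_sub_left, g_D_normal hO hν hp hV hVt hX] at h
  rw [mem_complexTangent_iff hM hν hp]
  linear_combination -h

/-- Symmetry of `h` is available on tangent vectors only, so the argument rests on `∇` preserving
tangency. -/
theorem nablaSff_comm (hM : IsRealHypersurface M) (hO : IsOpen O)
    (hν : IsUnitNormalOn M O ν) (hp : p ∈ M ∩ O) {X U V : Amb n → CVec n}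
    (hX : X p ∈ complexTangent M p) (hU : DifferentiableWithinAt ℝ U M p)
    (hV : DifferentiableWithinAt ℝ V M p)
    (hUt : ∀ q ∈ M ∩ O, g (U q) (ofReal (ν q)) = 0)
    (hVt : ∀ q ∈ M ∩ O, g (V q) (ofReal (ν q)) = 0) :
    nablaSff M ν X U V p = nablaSff M ν X V U p := by
  have h : D M (fun q => sff M ν q (U q) (V q)) p (X p) =
      D M (fun q => sff M ν q (V q) (U q)) p (X p) := by
    refine D_congr hp.1 ?_ _
    filter_upwards [eventually_mem hO hp] with q hq
    exact sff_comm hM hO hν hq ((mem_complexTangent_iff hM hν hq).2 (hUt q hq))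
      ((mem_complexTangent_iff hM hν hq).2 (hVt q hq))
  rw [nablaSff, nablaSff, h,
    sff_comm hM hO hν hp (nabla_mem_complexTangent hM hO hν hp hU hUt hX)
      ((mem_complexTangent_iff hM hν hp).2 (hVt p hp)),
    sff_comm hM hO hν hp ((mem_complexTangent_iff hM hν hp).2 (hUt p hp))
      (nabla_mem_complexTangent hM hO hν hp hV hVt hX)]
  ring

/-- The Codazzi equation for the connection `∇` and arbitrary tangent fields. -/
theorem nablaSff_sub_nablaSff (hM : IsRealHypersurface M) (hO : IsOpen O)
    (hν : IsUnitNormalOn M O ν) (hp : p ∈ M ∩ O) {X U V : Amb n → CVec n}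
    (hX : DifferentiableWithinAt ℝ X M p) (hU : DifferentiableWithinAt ℝ U M p)
    (hV : DifferentiableWithinAt ℝ V M p)
    (hXt : ∀ q ∈ M ∩ O, g (X q) (ofReal (ν q)) = 0)
    (hUt : ∀ q ∈ M ∩ O, g (U q) (ofReal (ν q)) = 0)
    (hVt : ∀ q ∈ M ∩ O, g (V q) (ofReal (ν q)) = 0) :
    nablaSff M ν X U V p - nablaSff M ν V U X p =
      Complex.I * (sff M ν p (holPart ν U p) (X p) - sff M ν p (antiholPart ν U p) (X p)) *
        sff M ν p (T ν p) (V p) -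
      Complex.I * (sff M ν p (holPart ν U p) (V p) - sff M ν p (antiholPart ν U p) (V p)) *
        sff M ν p (T ν p) (X p) +
      2 * tPart ν U p * g (J (D M (fun q => ofReal (ν q)) p (X p)))
        (D M (fun q => ofReal (ν q)) p (V p)) +
      Complex.I * (sff M ν p (holPart ν V p) (X p) - sff M ν p (antiholPart ν V p) (X p)) *
        sff M ν p (T ν p) (U p) +
      tPart ν V p * g (J (D M (fun q => ofReal (ν q)) p (X p)))
        (D M (fun q => ofReal (ν q)) p (U p)) -
      Complex.I * (sff M ν p (holPart ν X p) (V p) - sff M ν p (antiholPart ν X p) (V p)) *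
        sff M ν p (T ν p) (U p) -
      tPart ν X p * g (J (D M (fun q => ofReal (ν q)) p (V p)))
        (D M (fun q => ofReal (ν q)) p (U p)) := by
  have hXp := (mem_complexTangent_iff hM hν hp).2 (hXt p hp)
  have hUp := (mem_complexTangent_iff hM hν hp).2 (hUt p hp)
  have hVp := (mem_complexTangent_iff hM hν hp).2 (hVt p hp)
  have e1 := D_sff_sub_D_sff hM hO hν hp hX hU hV hXt hVt
  have e2 := sff_D_sub_nabla hO hν hp hU hUt hXp hVp
  have e3 := sff_D_sub_nabla hO hν hp hU hUt hVp hXp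
  have e4 := sff_D_sub_nabla hO hν hp hV hVt hXp hUp
  have e5 := sff_D_sub_nabla hO hν hp hX hXt hVp hUp
  -- Each bracketed difference has a normal component, `-h(V, X)` and `-h(X, V)` respectively; these
  -- cancel. Only the combined vector may therefore be moved to the first slot of `h`.
  have htan : (D M V p (X p) - nabla M ν X V p) - (D M X p (V p) - nabla M ν V X p) ∈
      complexTangent M p := by
    rw [mem_complexTangent_iff hM hν hp, g_sub_left, g_D_sub_nabla_normal hO hν hp hV hVt hXp,
      g_D_sub_nabla_normal hO hν hp hX hXt hVp, sff_comm hM hO hν hp hXp hVp, sub_self]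
  have e6 := sff_comm hM hO hν hp hUp htan
  -- `J` is skew, so antisymmetrising the `U` terms in `X` and `V` doubles this form, which is the
  -- source of the coefficient `2`.
  have e7 : g (J (D M (fun q => ofReal (ν q)) p (V p))) (D M (fun q => ofReal (ν q)) p (X p)) =
      -g (J (D M (fun q => ofReal (ν q)) p (X p))) (D M (fun q => ofReal (ν q)) p (V p)) := by
    rw [g_J_left, g_comm]
  rw [sff_sub_left (D M V p (X p) - nabla M ν X V p), e4, e5, sff_sub_right, sff_sub_right,
    sff_sub_right] at e6
  rw [sff_sub_right] at e1
  rw [sff_sub_left] at e2 e3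
  rw [e7] at e3
  simp only [nablaSff]
  linear_combination e1 + e2 - e3 + e6

end Connection

/-! ### Frame components: parts of the frame fields, inverse metric, expansion of tangent vectors.
-/

section Frame

variable {n : ℕ} {M O : Set (Amb n)} {p : Amb n} {ν : Amb n → Amb n} {Z : Fin n → Amb n → CVec n}

theorem J_conj (V : CVec n) : J (conj V) = conj (J V) := by
  ext k <;> simp [J, conj]

theorem IsHolFrameOn.mem (hZ : IsHolFrameOn M O Z) (hp : p ∈ M ∩ O) (α : Fin n) :
    Z α p ∈ holTangent M p := by
  rw [← hZ.span p hp]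
  exact Submodule.subset_span ⟨α, rfl⟩

theorem IsHolFrameOn.snd_eq_zero (hZ : IsHolFrameOn M O Z) (hp : p ∈ M ∩ O) (α : Fin n) :
    (Z α p).2 = 0 := (J_eq_I_smul_iff _).1 (hZ.mem hp α).2

theorem g_conj_normal {V : CVec n} {q : Amb n} (h : g V (ofReal (ν q)) = 0) :
    g (conj V) (ofReal (ν q)) = 0 := by
  rw [← conj_ofReal, g_conj, h, star_zero]

theorem g_T_eq_zero_of_snd {V : CVec n} {q : Amb n} (h0 : V.2 = 0)
    (h : g V (ofReal (ν q)) = 0) : g V (T ν q) = 0 := by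
  have := g_J_left V (ofReal (ν q))
  rw [(J_eq_I_smul_iff V).2 h0, g_smul_left, h] at this
  rw [T]
  linear_combination this

theorem parts_of_snd_eq_zero {V : Amb n → CVec n} (h0 : (V p).2 = 0)
    (h : g (V p) (ofReal (ν p)) = 0) :
    holPart ν V p = V p ∧ antiholPart ν V p = 0 ∧ tPart ν V p = 0 := by
  have ht : tPart ν V p = 0 := g_T_eq_zero_of_snd h0 h
  refine ⟨?_, ?_, ht⟩
  · rw [holPart, ht, zero_smul, sub_zero, ← h0]
  · rw [antiholPart, ht, zero_smul, sub_zero, h0]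
    rfl

theorem parts_conjField {V : Amb n → CVec n} (h0 : (V p).2 = 0)
    (h : g (V p) (ofReal (ν p)) = 0) :
    holPart ν (conjField V) p = 0 ∧ antiholPart ν (conjField V) p = conj (V p) ∧
      tPart ν (conjField V) p = 0 := by
  have h1 : (conj (V p)).1 = 0 := by simp [conj, h0]
  have ht : tPart ν (conjField V) p = 0 := by
    rw [tPart, conjField, ← conj_T, g_conj, g_T_eq_zero_of_snd h0 h, star_zero]
  refine ⟨?_, ?_, ht⟩
  · rw [holPart, ht, zero_smul, sub_zero, conjField, h1]
    rfl
  · rw [antiholPart, ht, zero_smul, sub_zero, conjField, ← h1]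

theorem parts_T (hν : IsUnitNormalOn M O ν) (hp : p ∈ M ∩ O) :
    holPart ν (T ν) p = 0 ∧ antiholPart ν (T ν) p = 0 ∧ tPart ν (T ν) p = 1 := by
  have ht : tPart ν (T ν) p = 1 := g_T_T hν hp
  refine ⟨?_, ?_, ht⟩
  · rw [holPart, ht, one_smul, sub_self]
    rfl
  · rw [antiholPart, ht, one_smul, sub_self]
    rfl

/-- `g(V, V̄)` is half the sum of the squared moduli of all coordinates. -/
theorem g_self_conj_eq_zero {V : CVec n} (h : g V (conj V) = 0) : V = 0 := by
  have h1 : g V (conj V) =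
      ((1 / 2 * ∑ k, (Complex.normSq (V.1 k) + Complex.normSq (V.2 k)) : ℝ) : ℂ) := by
    simp only [g, conj, Pi.star_apply, Complex.ofReal_mul, Complex.ofReal_sum, Complex.ofReal_add,
      ← Complex.mul_conj]
    simp
  rw [h1] at h
  have h2 : ∑ k, (Complex.normSq (V.1 k) + Complex.normSq (V.2 k)) = 0 := by
    have h3 := Complex.ofReal_eq_zero.1 h
    linarith
  rw [Finset.sum_eq_zero_iff_of_nonneg
    (fun k _ => add_nonneg (Complex.normSq_nonneg _) (Complex.normSq_nonneg _))] at h2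
  ext k
  · have := h2 k (Finset.mem_univ k)
    exact Complex.normSq_eq_zero.1
      (by linarith [Complex.normSq_nonneg (V.1 k), Complex.normSq_nonneg (V.2 k)])
  · have := h2 k (Finset.mem_univ k)
    exact Complex.normSq_eq_zero.1
      (by linarith [Complex.normSq_nonneg (V.1 k), Complex.normSq_nonneg (V.2 k)])

theorem conj_sum {ι : Type*} (s : Finset ι) (V : ι → CVec n) :
    conj (∑ i ∈ s, V i) = ∑ i ∈ s, conj (V i) := map_sum (conjCLM n) V s

theorem g_sum_right {ι : Type*} (s : Finset ι) (V : ι → CVec n) (W : CVec n) :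
    g W (∑ i ∈ s, V i) = ∑ i ∈ s, g W (V i) := by
  rw [g_comm, g_sum_left]
  exact Finset.sum_congr rfl fun i _ => g_comm _ _

/-- The metric is non-degenerate on the holomorphic tangent space. -/
theorem gram_det_ne_zero (hZ : IsHolFrameOn M O Z) (hp : p ∈ M ∩ O) : (gram Z p).det ≠ 0 := by
  intro h
  -- A null vector of the Gram matrix yields a combination of the frame orthogonal to every `Z̄_m`,
  -- hence to its own conjugate; positivity makes it zero, against independence.
  obtain ⟨v, hv, hv0⟩ := Matrix.exists_vecMul_eq_zero_iff.2 h
  have h1 : ∀ m, g (∑ k, v k • Z k p) (conj (Z m p)) = 0 := fun m => by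
    rw [g_sum_left]
    have := congrFun hv0 m
    simp only [Matrix.vecMul, dotProduct, gram, Matrix.of_apply, Pi.zero_apply] at this
    simpa only [g_smul_left] using this
  have h2 : ∑ k, v k • Z k p = 0 := by
    refine g_self_conj_eq_zero ?_
    conv_lhs => arg 2; rw [conj_sum]
    rw [g_sum_right]
    exact Finset.sum_eq_zero fun m _ => by rw [conj_smul, g_smul_right, h1, mul_zero]
  exact hv (funext (Fintype.linearIndependent_iff.1 (hZ.indep p hp) v h2))

theorem sum_gInv_mul_gram (hZ : IsHolFrameOn M O Z) (hp : p ∈ M ∩ O) (k l : Fin n) :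
    ∑ m, gram Z p k m * gInv Z p l m = if k = l then 1 else 0 := by
  have h := Matrix.mul_nonsing_inv (gram Z p) (gram_det_ne_zero hZ hp).isUnit
  have h1 := congrFun (congrFun h k) l
  rwa [Matrix.mul_apply, Matrix.one_apply] at h1

theorem sum_gInv_mul_gram' (hZ : IsHolFrameOn M O Z) (hp : p ∈ M ∩ O) (k l : Fin n) :
    ∑ m, gInv Z p m l * gram Z p m k = if l = k then 1 else 0 := by
  have h := Matrix.nonsing_inv_mul (gram Z p) (gram_det_ne_zero hZ hp).isUnit
  have h1 := congrFun (congrFun h l) k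
  rwa [Matrix.mul_apply, Matrix.one_apply] at h1

theorem exists_frame_coords (hZ : IsHolFrameOn M O Z) (hp : p ∈ M ∩ O) {V : CVec n}
    (hV : V ∈ holTangent M p) : ∃ c : Fin n → ℂ, V = ∑ k, c k • Z k p := by
  rw [← hZ.span p hp, SetLike.mem_coe, Submodule.mem_span_range_iff_exists_fun] at hV
  obtain ⟨c, hc⟩ := hV
  exact ⟨c, hc.symm⟩

theorem g_eq_zero_of_snd {V W : CVec n} (hV : V.2 = 0) (hW : W.2 = 0) : g V W = 0 := by
  simp [g, hV, hW]

theorem g_eq_zero_of_fst {V W : CVec n} (hV : V.1 = 0) (hW : W.1 = 0) : g V W = 0 := by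
  simp [g, hV, hW]

/-- The expansion of a complexified tangent vector with respect to `Z_α, Z_ᾱ, T`. -/
theorem frame_expansion (hM : IsRealHypersurface M) (hν : IsUnitNormalOn M O ν)
    (hZ : IsHolFrameOn M O Z) (hp : p ∈ M ∩ O) {V : CVec n} (hV : V ∈ complexTangent M p) :
    V = ∑ l, (∑ m, gInv Z p l m * g (conj (Z m p)) V) • Z l p +
      ∑ l, (∑ m, gInv Z p m l * g (Z m p) V) • conj (Z l p) + g V (T ν p) • T ν p := by
  have hdec := decomposition ν (fun _ => V) p
  have hn := g_holPart_antiholPart_normal hν hp (V := fun _ => V)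
    ((mem_complexTangent_iff hM hν hp).1 hV)
  set A := holPart ν (fun _ => V) p with hA
  set B := antiholPart ν (fun _ => V) p with hB
  have hA2 : A.2 = 0 := rfl
  have hB1 : B.1 = 0 := rfl
  obtain ⟨a, ha⟩ := exists_frame_coords hZ hp (V := A)
    ⟨(mem_complexTangent_iff hM hν hp).2 hn.1, J_mk_zero _⟩
  -- The frame spans only type (1,0), so the (0,1) part is conjugated before being expanded.
  obtain ⟨b, hb⟩ := exists_frame_coords hZ hp (V := conj B)
    ⟨(mem_complexTangent_iff hM hν hp).2 (g_conj_normal hn.2),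
      (J_eq_I_smul_iff _).2 (by simp [conj, hB1])⟩
  have hb' : B = ∑ k, star (b k) • conj (Z k p) := by
    rw [← conj_conj B, hb, conj_sum]
    exact Finset.sum_congr rfl fun k _ => conj_smul _ _
  have hZn : ∀ m, g (Z m p) (ofReal (ν p)) = 0 := fun m =>
    (mem_complexTangent_iff hM hν hp).1 (hZ.mem hp m).1
  have hZT : ∀ m, g (Z m p) (T ν p) = 0 := fun m =>
    g_T_eq_zero_of_snd (hZ.snd_eq_zero hp m) (hZn m)
  have hZT' : ∀ m, g (conj (Z m p)) (T ν p) = 0 := fun m => by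
    rw [← conj_T, g_conj, hZT, star_zero]
  have hZ1 : ∀ m, (conj (Z m p)).1 = 0 := fun m => by simp [conj, hZ.snd_eq_zero hp m]
  -- Pairing with `Z̄_m` annihilates the (0,1) part and `T`, leaving the Gram matrix applied to `a`,
  -- which the inverse metric undoes.
  have ha1 : ∀ l, ∑ m, gInv Z p l m * g (conj (Z m p)) V = a l := fun l => by
    have h1 : ∀ m, g (conj (Z m p)) V = ∑ k, a k * gram Z p k m := fun m => by
      rw [hdec, g_add_right, g_add_right, g_smul_right, hZT', g_eq_zero_of_fst (hZ1 m) hB1, ha,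
        g_sum_right, mul_zero, add_zero, add_zero]
      exact Finset.sum_congr rfl fun k _ => by rw [g_smul_right, g_comm]; rfl
    simp_rw [h1, Finset.mul_sum]
    rw [Finset.sum_comm]
    have h2 : ∀ k, ∑ m, gInv Z p l m * (a k * gram Z p k m) = a k * if k = l then 1 else 0 :=
      fun k => by
        rw [← sum_gInv_mul_gram hZ hp, Finset.mul_sum]
        exact Finset.sum_congr rfl fun m _ => by ring
    simp [h2]
  have hb1 : ∀ l, ∑ m, gInv Z p m l * g (Z m p) V = star (b l) := fun l => by
    have h1 : ∀ m, g (Z m p) V = ∑ k, star (b k) * gram Z p m k := fun m => by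
      rw [hdec, g_add_right, g_add_right, g_smul_right, hZT,
        g_eq_zero_of_snd (hZ.snd_eq_zero hp m) hA2, hb', g_sum_right, mul_zero, add_zero, zero_add]
      exact Finset.sum_congr rfl fun k _ => by rw [g_smul_right]; rfl
    simp_rw [h1, Finset.mul_sum]
    rw [Finset.sum_comm]
    have h2 : ∀ k, ∑ m, gInv Z p m l * (star (b k) * gram Z p m k) =
        star (b k) * if l = k then 1 else 0 := fun k => by
      rw [← sum_gInv_mul_gram' hZ hp, Finset.mul_sum]
      exact Finset.sum_congr rfl fun m _ => by ring
    rw [Finset.sum_congr rfl fun k _ => h2 k]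
    simp
  simp_rw [ha1, hb1]
  rw [← ha, ← hb']
  exact hdec

/-- The form `g(J D_X ν, D_Y ν)` in terms of the second fundamental form. -/
theorem g_J_D_normal (hM : IsRealHypersurface M) (hO : IsOpen O) (hν : IsUnitNormalOn M O ν)
    (hZ : IsHolFrameOn M O Z) (hp : p ∈ M ∩ O) {X Y : CVec n} (hX : X ∈ complexTangent M p)
    (hY : Y ∈ complexTangent M p) :
    g (J (D M (fun q => ofReal (ν q)) p X)) (D M (fun q => ofReal (ν q)) p Y) =
      Complex.I * ∑ l, sff M ν p (Z l p) Y * sffUp M ν Z p l X -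
        Complex.I * ∑ l, sff M ν p (conj (Z l p)) Y * sffUpBar M ν Z p l X := by
  have hS : D M (fun q => ofReal (ν q)) p X ∈ complexTangent M p := by
    rw [mem_complexTangent_iff hM hν hp, g_comm]
    exact sff_normal_eq_zero hO hν hp hX
  rw [frame_expansion hM hν hZ hp hS, J_add, J_add, J_sum, J_sum, J_smul, J_T, g_add_left,
    g_add_left, g_smul_left, g_neg_left, g_sum_left, g_sum_left, Finset.mul_sum, Finset.mul_sum]
  -- The `T` component of `D_X ν` is sent by `J` to a multiple of `-ν`, which is orthogonal to `D_Y
  -- ν`; hence no `h(T, ·)` terms appear.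
  have h0 : g (ofReal (ν p)) (D M (fun q => ofReal (ν q)) p Y) = 0 :=
    sff_normal_eq_zero hO hν hp hY
  rw [h0, neg_zero, mul_zero, add_zero, sub_eq_add_neg, ← Finset.sum_neg_distrib]
  congr 1
  · refine Finset.sum_congr rfl fun l _ => ?_
    rw [J_smul, (hZ.mem hp l).2, g_smul_left, g_smul_left]
    simp only [sff, sffUp]
    ring
  · refine Finset.sum_congr rfl fun l _ => ?_
    rw [J_smul, J_conj, (hZ.mem hp l).2, conj_smul, g_smul_left, g_smul_left]
    simp only [sff, sffUpBar, Complex.star_def, Complex.conj_I]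
    ring

end Frame

end CRHypersurface

/-! ### The four Codazzi equations as specialisations of the general identity. -/

open CRHypersurface in
theorem theorem4p1 (n : ℕ) (M O : Set (Amb n)) (hM : IsRealHypersurface M) (hO : IsOpen O)
    (ν : Amb n → Amb n) (hν : IsUnitNormalOn M O ν)
    (Z : Fin n → Amb n → CVec n) (hZ : IsHolFrameOn M O Z)
    (p : Amb n) (hp : p ∈ M ∩ O) :
    (∀ α β γ : Fin n,
      nablaSff M ν (Z β) (Z α) (conjField (Z γ)) p - nablaSff M ν (conjField (Z γ)) (Z α) (Z β) p
        = Complex.I * sff M ν p (Z α p) (Z β p) * sff M ν p (conj (Z γ p)) (T ν p)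
          - Complex.I * sff M ν p (Z α p) (conj (Z γ p)) * sff M ν p (Z β p) (T ν p)
          - 2 * Complex.I * sff M ν p (Z β p) (conj (Z γ p)) * sff M ν p (Z α p) (T ν p)) ∧
    (∀ α β : Fin n,
      nablaSff M ν (conjField (Z β)) (Z α) (T ν) p - nablaSff M ν (T ν) (Z α) (conjField (Z β)) p
        = Complex.I * ∑ l, sff M ν p (Z α p) (Z l p) * sffUp M ν Z p l (conj (Z β p))
          - Complex.I * ∑ l, sff M ν p (Z α p) (conj (Z l p)) * sffUpBar M ν Z p l (conj (Z β p))
          + Complex.I * sff M ν p (Z α p) (conj (Z β p)) * sff M ν p (T ν p) (T ν p)) ∧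
    (∀ α β : Fin n,
      nablaSff M ν (Z β) (Z α) (T ν) p - nablaSff M ν (T ν) (Z α) (Z β) p
        = Complex.I * ∑ l, sff M ν p (Z β p) (conj (Z l p)) * sffUpBar M ν Z p l (Z α p)
          - Complex.I * ∑ l, sff M ν p (Z β p) (Z l p) * sffUp M ν Z p l (Z α p)
          + Complex.I * sff M ν p (Z α p) (Z β p) * sff M ν p (T ν p) (T ν p)
          - 2 * Complex.I * sff M ν p (Z α p) (T ν p) * sff M ν p (Z β p) (T ν p)) ∧
    (∀ α : Fin n,
      nablaSff M ν (Z α) (T ν) (T ν) p - nablaSff M ν (T ν) (Z α) (T ν) p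
        = 2 * Complex.I * ∑ l, sffUp M ν Z p l (Z α p) * sff M ν p (Z l p) (T ν p)
          - 2 * Complex.I * ∑ l, sffUpBar M ν Z p l (Z α p) * sff M ν p (conj (Z l p)) (T ν p)
          - Complex.I * ∑ l, sff M ν p (Z α p) (Z l p) * sffUp M ν Z p l (T ν p)
          + Complex.I * ∑ l, sff M ν p (Z α p) (conj (Z l p)) * sffUpBar M ν Z p l (T ν p)
          - Complex.I * sff M ν p (Z α p) (T ν p) * sff M ν p (T ν p) (T ν p)) := by

  have hTt : ∀ q ∈ M ∩ O, g (T ν q) (ofReal (ν q)) = 0 := fun q _ => g_T_normal q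
  have hZt : ∀ α, ∀ q ∈ M ∩ O, g (Z α q) (ofReal (ν q)) = 0 := fun α q hq =>
    (mem_complexTangent_iff hM hν hq).1 (hZ.mem hq α).1
  have hCt : ∀ α, ∀ q ∈ M ∩ O, g (conjField (Z α) q) (ofReal (ν q)) = 0 := fun α q hq =>
    g_conj_normal (hZt α q hq)
  have hTd := differentiableWithinAt_T hO hν hp
  have hZd : ∀ α, DifferentiableWithinAt ℝ (Z α) M p := fun α =>
    (hZ.smooth α).differentiableWithinAt hO hp
  have hCd : ∀ α, DifferentiableWithinAt ℝ (conjField (Z α)) M p := fun α =>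
    (conjCLM n).differentiableAt.comp_differentiableWithinAt p (hZd α)
  have hTm := (mem_complexTangent_iff hM hν hp).2 (hTt p hp)
  have hZm : ∀ α, Z α p ∈ complexTangent M p := fun α => (hZ.mem hp α).1
  have hCm : ∀ α, conj (Z α p) ∈ complexTangent M p := fun α => conj_mem_complexTangent (hZm α)
  have hZp := fun α => parts_of_snd_eq_zero (hZ.snd_eq_zero hp α) (hZt α p hp)
  have hCp := fun α => parts_conjField (hZ.snd_eq_zero hp α) (hZt α p hp)
  have hTp := parts_T hν hp
  have hZ1 := fun α => (hZp α).1
  have hZ2 := fun α => (hZp α).2.1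
  have hZ3 := fun α => (hZp α).2.2
  have hC1 := fun α => (hCp α).1
  have hC2 := fun α => (hCp α).2.1
  have hC3 := fun α => (hCp α).2.2
  have hTZ := fun α => sff_comm hM hO hν hp hTm (hZm α)
  have hTC := fun α => sff_comm hM hO hν hp hTm (hCm α)
  have hCZ := fun α β => sff_comm hM hO hν hp (hCm α) (hZm β)
  have hcf : ∀ α, conjField (Z α) p = conj (Z α p) := fun _ => rfl
  have hc := fun {X Y : CVec n} (hX : X ∈ complexTangent M p) (hY : Y ∈ complexTangent M p) =>
    g_J_D_normal hM hO hν hZ hp hX hY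
  have hanti : ∀ A B : CVec n, g (J A) B = -g (J B) A := fun A B => by rw [g_J_left, g_comm]
  refine ⟨fun α β γ => ?_, fun α β => ?_, fun α β => ?_, fun α => ?_⟩
  · rw [nablaSff_sub_nablaSff hM hO hν hp (hZd β) (hZd α) (hCd γ) (hZt β) (hZt α) (hCt γ)]
    simp only [hZ1, hZ2, hZ3, hC1, hC2, hC3, hcf, hTZ, hTC, hCZ, sff_zero_left]
    ring
  · rw [nablaSff_sub_nablaSff hM hO hν hp (hCd β) (hZd α) hTd (hCt β) (hZt α) hTt]
    simp only [hZ1, hZ2, hZ3, hC1, hC2, hC3, hTp.1, hTp.2.1, hTp.2.2, hcf, hTZ, hTC,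
      sff_zero_left, hc (hCm β) (hZm α)]
    simp only [sff_comm hM hO hν hp (hZm _) (hZm α), hCZ]
    ring
  · rw [nablaSff_sub_nablaSff hM hO hν hp (hZd β) (hZd α) hTd (hZt β) (hZt α) hTt]
    simp only [hZ1, hZ2, hZ3, hTp.1, hTp.2.1, hTp.2.2, hTZ, sff_zero_left,
      -- Here the skew form appears as `g(J D_β ν, D_α ν)`, while the raised index in the claim goes
      -- with `α`. The arguments of `hanti` are fixed so that the exchange happens once.
      hanti (D M _ p (Z β p)) (D M _ p (Z α p)), hc (hZm α) (hZm β)]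
    simp only [sff_comm hM hO hν hp (hZm _) (hZm β), hCZ]
    ring
  -- The general identity exchanges the direction with the last slot, so `∇_0 h_{α0}` is first read
  -- as `∇_0 h_{0α}`, making `T` the common middle field.
  · rw [nablaSff_comm hM hO hν hp hTm (hZd α) hTd (hZt α) hTt,
      nablaSff_sub_nablaSff hM hO hν hp (hZd α) hTd hTd (hZt α) hTt hTt]
    have h1 := hc (hZm α) hTm
    have h2 := hc hTm (hZm α)
    rw [hanti] at h2
    simp only [hZ1, hZ2, hZ3, hTp.1, hTp.2.1, hTp.2.2, hTZ, sff_zero_left]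
    simp only [sff_comm hM hO hν hp (hZm _) (hZm α), hCZ, mul_comm (sffUp _ _ _ _ _ (Z α p)),
      mul_comm (sffUpBar _ _ _ _ _ (Z α p))] at h1 h2 ⊢
    -- The skew form occurs three times: two copies are expanded through `D_α ν` and one, with the
    -- opposite sign, through `D_T ν`, giving the two kinds of sums in the claim.
    linear_combination 2 * h1 - h2
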